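/- **Setting.** Let $\Sigma=\mathbb{N}_0^{\mathbb{Z}}$, ordered coordinatewise ($\preccurlyeq$), and for a finite $I\subset\mathbb{Z}$ put $\eta(I)=\sum_{x\in I}\eta(x)$. Let $J=(a,b)$ with $0\le a<b<\infty$. An *environment* consists of probability measures $\mu_\rho$ on $\Sigma$ ($\rho\in J$), each invariant under the translations of $\mathbb{Z}$, and of a Markov kernel $\eta_0\mapsto\mathbf{P}^{\eta_0}$ giving the law of a process $(\eta_t)_{t\in\mathbb{N}_0}$ in $\Sigma$ started from $\eta_0\in\Sigma$, such that, with $\mathbf{P}^\rho=\int\mu_\rho(d\eta_0)\mathbf{P}^{\eta_0}$: * (P.1) under $\mathbf{P}^{\eta_0}$, for all $s\in\mathbb{N}_0$ and $x\in\mathbb{Z}$, given $\eta_0,\dots,\eta_s$ the process $(\eta_{s+t}(x+\cdot))_{t\ge0}$ has law $\mathbf{P}^{\eta_s(x+\cdot)}$; * (P.2) under $\mathbf{P}^\rho$, $(\eta_{s+t})_{t\ge0}$ has the same law as $(\eta_t)_{t\ge0}$ for all $s\in\mathbb{N}_0$, $\rho\in J$; * (P.3) if $\eta_0'\preccurlyeq\eta_0$,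 then $\mathbf{P}^{\eta_0'}$ and $\mathbf{P}^{\eta_0}$ can be coupled so that a.s. $\eta'_t\preccurlyeq\eta_t$ for all $t$; if $\rho'\le\rho$ in $J$, then $\mu_{\rho'}$ and $\mu_\rho$ can be coupled so that a.s. $\eta_0'\preccurlyeq\eta_0$; * (P.4) there is $c>0$ such that for all $\rho\in J$, $\varepsilon\in(0,1)$ and integers $\ell\ge1$, $\mathbf{P}^\rho(|\eta_0(\{0,\dots,\ell-1\})-\rho\ell|\ge\varepsilon\ell)\le2e^{-c\varepsilon^2\ell}$. Assume moreover that for some $\nu>0$ the following two conditions hold (intervals are intersected with $\mathbb{Z}$). * (No particle drifting in from the side.) For all integers $t,H\ge0$, $k\ge1$ and all $\eta_0,\eta_0'\in\Sigma$ with $\eta_0\succcurlyeq\eta'_0$ on $[-H,H]$, there is a coupling $\mathbb{Q}$ of $\mathbf{P}^{\eta_0}$ and $\mathbf{P}^{\eta_0'}$ with $$\mathbb{Q}\big(\forall s\in\{0,\dots,t\}:\ \eta_s\succcurlyeq\eta_s'\text{ on }[-H+2\nu kt,H-2\nu kt]\big)\ge1-20e^{-k\nu t/4}.$$ * (Covering.)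 There are $C,C'>0$ such that for all $\rho\in J$ and $\varepsilon\in(0,1)$ with $\rho+\varepsilon\in J$, and all integers $H,t\ge1$ with $H>4\nu t$, $\nu^8t>1$ and $\nu t^{1/4}>C\varepsilon^{-2}(1+|\log^3(\nu t)|)$, the following holds with $\ell=\lfloor t^{1/4}\rfloor$. If $\eta_0(I)\ge(\rho+\tfrac{3\varepsilon}4)|I|$ and $\eta_0'(I)\le(\rho+\tfrac\varepsilon4)|I|$ for every interval $I\subset[-H,H]$ with $\lfloor\ell/2\rfloor\le|I|\le\ell$, then there is a coupling $\mathbb{Q}$ of $\mathbf{P}^{\eta_0}$ and $\mathbf{P}^{\eta_0'}$ with $$\mathbb{Q}\big(\eta_t\succcurlyeq\eta_t'\text{ on }[-H+4\nu t,H-4\nu t]\big)\ge1-C'tH\exp\!\Big(-\frac{\varepsilon^2t^{1/4}}{C'(1+\nu^{-1})}\Big).$$ Fix $0\le p_\circ<p_\bullet\le1$. Given $\eta=(\eta_t)_{t\in\mathbb{N}_0}$ and i.i.d. uniform variables $U_0,U_1,\dots$ on $[0,1]$ independent of $\eta$, the walk is $X_0=0$, $$X_{n+1}=X_n+2\cdot\mathbf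 1\{U_n\le(p_\circ-p_\bullet)\mathbf 1\{\eta_n(X_n)=0\}+p_\bullet\}-1 .$$ Let $\mathbb{P}^\rho$ be the joint (annealed) law when $\eta\sim\mathbf{P}^\rho$. For $L\ge1$, let $\mathbb{E}^{\rho,L}$ be the corresponding expectation when the environment is instead resampled from $\mu_\rho$, independently of the past, at each multiple of $L$, evolving as before in between. Put $v(\rho,L)=\mathbb{E}^{\rho,L}[X_L/L]$, let $\bar J$ be the set of $\rho\in J$ for which $v(\rho)=\lim_{L\to\infty}v(\rho,L)$ exists, and $$v^+(\rho)=\lim_{\rho'\downarrow\rho,\ \rho'\in\bar J}v(\rho'),\qquad v^-(\rho)=\lim_{\rho'\uparrow\rho,\ \rho'\in\bar J}v(\rho').$$ **Lemma 4.2 (Deviation Lemma).** Let $\rho\in J$. Then $\rho$ is an accumulation point of both $\bar J\cap(\rho,\infty)$ and $\bar J\cap(-\infty,\rho)$, and the limits $v^+(\rho)$ and $v^-(\rho)$ exist in $\mathbb{R}$. Moreover, for every $\delta>0$ there is $k_0=k_0(\rho,\delta)\in\mathbb{N}$ such that for all integers $n\ge L>k_0$ with $n\ge12L/\delta$ and every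 real number $f(L)\in[(\log L)^{90},L^{1/10}]$, $$\mathbb{P}^\rho\Big(\frac{X_n}n\notin\big(v^-(\rho)-\delta,\ v^+(\rho)+\delta\big)\Big)\le2\Big(\Big\lceil\frac nL\Big\rceil-1\Big)^2\exp\!\big(-f(L)^{1/40}\big)+2\exp\!\Big(-\frac{\delta^2n}{2^9L}\Big).$$ -/

import Mathlib

open MeasureTheory ProbabilityTheory Filter Topology

/-- Particle configurations on `ℤ` (number of particles at each site). -/
abbrev Config : Type := ℤ → ℕ

/-- Space-time trajectories `η = (η_t)_{t = 0, 1, 2, …}` of a particle configuration. -/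
abbrev EnvPath : Type := ℕ → Config

/-- The configuration seen from `x`, i.e. `σ(x + ·)`. -/
def Config.translate (x : ℤ) (σ : Config) : Config := fun y => σ (x + y)

/-- The trajectory seen from time `s` and site `x`, i.e. `(η_{s+t}(x + ·))_{t ≥ 0}`. -/
def EnvPath.shift (s : ℕ) (x : ℤ) (η : EnvPath) : EnvPath :=
  fun t => Config.translate x (η (s + t))

/-- `σ(I)`, the number of particles in the interval `I = {y, …, y + m - 1}` of length `m`. -/
noncomputable def Config.mass (σ : Config) (y : ℤ) (m : ℕ) : ℕ := ∑ x ∈ Finset.Ico y (y + m), σ x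

/-- `σ` dominates `σ'` at all integer sites of the real interval `[-r, r]`. -/
def DominatesOn (r : ℝ) (σ σ' : Config) : Prop := ∀ x : ℤ, |(x : ℝ)| ≤ r → σ' x ≤ σ x

/-- `Q` is a coupling of the laws `P` and `P'`. -/
def IsCoupling {α : Type*} [MeasurableSpace α] (Q : Measure (α × α)) (P P' : Measure α) : Prop :=
  Q.map Prod.fst = P ∧ Q.map Prod.snd = P'

/-- A dynamic random environment with densities in the interval `J = (a, b)`: a family of initial
laws `μ ρ` (only `ρ ∈ (a, b)` matters) and the laws `P σ` of the evolution started from `σ`,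
which is Markov, stationary under `μ ρ`, monotone, and has density `ρ` under `μ ρ`. -/
structure Environment (a b : ℝ) where
  /-- the law of the initial configuration at density `ρ` -/
  μ : ℝ → ProbabilityMeasure Config
  /-- the law of the environment started from a given configuration -/
  P : Kernel Config EnvPath
  [markovKernel : IsMarkovKernel P]
  /-- the evolution `P σ` starts from `σ` -/
  start : ∀ σ : Config, ∀ᵐ η ∂(P σ), η 0 = σ
  /-- Time-homogeneous Markov property and translation invariance of the dynamics: under `P σ`,
  given `η_0, …, η_s`, the process `(η_{s+t}(x + ·))_t` has law `P (η_s(x + ·))`. -/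
  markov : ∀ (σ : Config) (s : ℕ) (x : ℤ) (A B : Set EnvPath), MeasurableSet A →
    MeasurableSet[Filtration.piLE (X := fun _ : ℕ => Config) s] B →
    P σ (B ∩ EnvPath.shift s x ⁻¹' A) = ∫⁻ η in B, P (Config.translate x (η s)) A ∂(P σ)
  /-- the initial laws are translation invariant -/
  translation_invariant : ∀ ρ ∈ Set.Ioo a b, ∀ x : ℤ,
    (μ ρ : Measure Config).map (Config.translate x) = μ ρ
  /-- the environment started from `μ ρ` is stationary in time -/
  stationary : ∀ ρ ∈ Set.Ioo a b, ∀ s : ℕ,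
    ((μ ρ : Measure Config).bind P).map (EnvPath.shift s 0) = (μ ρ : Measure Config).bind P
  /-- quenched monotonicity -/
  monotone_quenched : ∀ σ σ' : Config, σ' ≤ σ → ∃ Q : Measure (EnvPath × EnvPath),
    IsCoupling Q (P σ) (P σ') ∧ ∀ᵐ ω ∂Q, ∀ t : ℕ, ω.2 t ≤ ω.1 t
  /-- monotonicity of the initial laws in the density -/
  monotone_density : ∀ ρ ∈ Set.Ioo a b, ∀ ρ' ∈ Set.Ioo a b, ρ' ≤ ρ →
    ∃ Q : Measure (Config × Config),
      IsCoupling Q (μ ρ : Measure Config) (μ ρ' : Measure Config) ∧ ∀ᵐ ω ∂Q, ω.2 ≤ ω.1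
  /-- concentration of the density -/
  density : ∃ c : ℝ, 0 < c ∧ ∀ ρ ∈ Set.Ioo a b, ∀ ε ∈ Set.Ioo (0 : ℝ) 1, ∀ l : ℕ, 1 ≤ l →
    ((μ ρ : Measure Config).bind P).real
        {η | ε * l ≤ |((η 0).mass 0 l : ℝ) - ρ * l|} ≤ 2 * Real.exp (-(c * ε ^ 2 * l))

namespace Environment

attribute [instance] Environment.markovKernel

variable {a b : ℝ}

/-- Condition "no particle drifting in from the side", with activity rate `ν`. -/
def NoDriftIn (E : Environment a b) (ν : ℝ) : Prop :=
  ∀ (t H k : ℕ), 1 ≤ k → ∀ σ σ' : Config, DominatesOn H σ σ' →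
    ∃ Q : Measure (EnvPath × EnvPath), IsCoupling Q (E.P σ) (E.P σ') ∧
      1 - 20 * Real.exp (-(k * ν * t / 4)) ≤
        Q.real {ω | ∀ s ≤ t, DominatesOn (H - 2 * ν * k * t) (ω.1 s) (ω.2 s)}

/-- Condition "covering of `η'` by `η`", with activity rate `ν`: two environments whose empirical
densities on `[-H, H]` are ordered can be coupled such that the denser one covers the other at
time `t` on a slightly smaller interval, with high probability. -/
def Covering (E : Environment a b) (ν : ℝ) : Prop :=
  ∃ C C' : ℝ, 0 < C ∧ 0 < C' ∧
    ∀ ρ ∈ Set.Ioo a b, ∀ ε ∈ Set.Ioo (0 : ℝ) 1, ρ + ε ∈ Set.Ioo a b →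
    ∀ H t : ℕ, 1 ≤ H → 1 ≤ t → 4 * ν * t < H → 1 < ν ^ 8 * t →
    C * (ε ^ 2)⁻¹ * (1 + |Real.log (ν * t) ^ 3|) < ν * (t : ℝ) ^ (1 / 4 : ℝ) →
    ∀ σ σ' : Config,
      (∀ (y : ℤ) (m : ℕ), ⌊(t : ℝ) ^ (1 / 4 : ℝ)⌋₊ / 2 ≤ m → m ≤ ⌊(t : ℝ) ^ (1 / 4 : ℝ)⌋₊ →
        Finset.Ico y (y + m) ⊆ Finset.Icc (-(H : ℤ)) H →
          (ρ + 3 * ε / 4) * m ≤ σ.mass y m ∧ (σ'.mass y m : ℝ) ≤ (ρ + ε / 4) * m) →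
      ∃ Q : Measure (EnvPath × EnvPath), IsCoupling Q (E.P σ) (E.P σ') ∧
        1 - C' * t * H * Real.exp (-((C' * (1 + ν⁻¹))⁻¹ * ε ^ 2 * (t : ℝ) ^ (1 / 4 : ℝ))) ≤
          Q.real {ω | DominatesOn (H - 4 * ν * t) (ω.1 t) (ω.2 t)}

/-- The law of the environment started from `μ ρ`. -/
noncomputable def law (E : Environment a b) (ρ : ℝ) : Measure EnvPath :=
  (E.μ ρ : Measure Config).bind E.P

instance (E : Environment a b) (ρ : ℝ) : IsProbabilityMeasure (E.law ρ) := by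
  unfold law; infer_instance

/-- The law of the finite-range environment: at the times `0, L, 2L, …` the configuration is
resampled from `μ ρ` independently of the past, and it evolves by the original dynamics in
between. Thus the successive blocks of length `L` are taken from independent copies. -/
noncomputable def finiteRangeLaw (E : Environment a b) (ρ : ℝ) (L : ℕ) : Measure EnvPath :=
  (Measure.infinitePi (fun _ : ℕ => E.law ρ)).map (fun ω t => ω (t / L) (t % L))

end Environment

/-- The random walk from `0` in the environment `η`, driven by the numbers `u_n ∈ [0,1]`; it jumps
to the right at time `n` iff `u_n ≤ (pE - pO) 1{η_n(X_n) = 0} + pO`, so with probability `pE` on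
empty sites and `pO` on occupied sites if `u_n` is uniform. -/
noncomputable def walk (pE pO : ℝ) (η : EnvPath) (u : ℕ → unitInterval) : ℕ → ℤ
  | 0 => 0
  | n + 1 => walk pE pO η u n +
      2 * (if (u n : ℝ) ≤ (pE - pO) * (if η n (walk pE pO η u n) = 0 then 1 else 0) + pO
        then 1 else 0) - 1

/-- The joint annealed law of the environment and of the i.i.d. uniform variables `(U_n)`, when
the environment has law `Q`. -/
noncomputable def annealed (Q : Measure EnvPath) : Measure (EnvPath × (ℕ → unitInterval)) :=
  Q.prod (Measure.infinitePi (fun _ : ℕ => (volume : Measure unitInterval)))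

namespace Environment

variable {a b : ℝ}

/-- `v(ρ, L)`, the mean of `X_L / L` in the finite-range environment. -/
noncomputable def finiteRangeSpeed (E : Environment a b) (pE pO ρ : ℝ) (L : ℕ) : ℝ :=
  ∫ ω, (walk pE pO ω.1 ω.2 L : ℝ) / L ∂(annealed (E.finiteRangeLaw ρ L))

/-- The densities `ρ ∈ (a, b)` at which `v(ρ, L)` converges as `L → ∞`. -/
def speedDomain (E : Environment a b) (pE pO : ℝ) : Set ℝ :=
  {ρ | ρ ∈ Set.Ioo a b ∧ ∃ v : ℝ, Tendsto (E.finiteRangeSpeed pE pO ρ) atTop (𝓝 v)}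

/-- `v(ρ) = lim_{L → ∞} v(ρ, L)`; meaningful for `ρ` in `speedDomain`. -/
noncomputable def speed (E : Environment a b) (pE pO ρ : ℝ) : ℝ :=
  limUnder atTop (E.finiteRangeSpeed pE pO ρ)

/-- `v⁺(ρ)`, the limit of `v(ρ')` as `ρ' ↓ ρ` within `speedDomain`. -/
noncomputable def speedPlus (E : Environment a b) (pE pO ρ : ℝ) : ℝ :=
  limUnder (𝓝[E.speedDomain pE pO ∩ Set.Ioi ρ] ρ) (E.speed pE pO)

/-- `v⁻(ρ)`, the limit of `v(ρ')` as `ρ' ↑ ρ` within `speedDomain`. -/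
noncomputable def speedMinus (E : Environment a b) (pE pO ρ : ℝ) : ℝ :=
  limUnder (𝓝[E.speedDomain pE pO ∩ Set.Iio ρ] ρ) (E.speed pE pO)

end Environment

/-!
Two walks driven by the same uniform variables in ordered environments stay ordered. If the
environments are ordered only from some time `t` on and around the walks, then a lead of `2 t` for
the upper walk still suffices. By covering, an environment which locally looks like density `ρ` is,
up to a small probability, dominated after a time of order `√L` by a fresh environment of density
`ρ + ε`. The walk in density `ρ` over many blocks of length `L` is therefore dominated, up to a lead
of order `√L` per block, by a sum of independent copies of a block in density `ρ + ε`, and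
Hoeffding's inequality bounds its deviations above `v(ρ + ε, L)`. Applied with `ε → 0`, this gives
`v(ρ, n) ≤ v(ρ + ε, L) + o(1)` for `n` at least `L ^ 2`, so that the upper limit at `ρ` is at most
the lower limit at any larger density. Hence `v` exists at all continuity points of the monotone
function `ρ ↦ limsup v(ρ, L)`, that is, outside a countable set. The deviations below `v⁻` follow in
the same way with all inequalities reversed; a sign `s = ±1` treats both directions at once.
-/

open scoped ENNReal

/-! ### The walk from an arbitrary site -/

/-- The walk of `walk`, started from `x` instead of `0`. -/
noncomputable def walkFrom (pE pO : ℝ) (x : ℤ) (η : EnvPath) (u : ℕ → unitInterval) (n : ℕ) : ℤ :=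
  x + walk pE pO (EnvPath.shift 0 x η) u n

/-- The increment of the walk at a site with `k` particles when the driving number is `r`. -/
noncomputable def jump (pE pO : ℝ) (k : ℕ) (r : unitInterval) : ℤ :=
  2 * (if (r : ℝ) ≤ (pE - pO) * (if k = 0 then 1 else 0) + pO then 1 else 0) - 1

lemma isUnit_jump (pE pO : ℝ) (k : ℕ) (r : unitInterval) : IsUnit (jump pE pO k r) := by
  rw [Int.isUnit_iff, jump]
  split_ifs <;> simp

lemma jump_mono {pE pO : ℝ} (hp : pE ≤ pO) {k k' : ℕ} (h : k ≤ k') (r : unitInterval) :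
    jump pE pO k r ≤ jump pE pO k' r := by
  have threshold_le : (pE - pO) * (if k = 0 then 1 else 0) + pO ≤
      (pE - pO) * (if k' = 0 then 1 else 0) + pO := by
    split_ifs
    · rfl
    · linarith
    · omega
    · rfl
  unfold jump
  gcongr
  by_cases hr : (r : ℝ) ≤ (pE - pO) * (if k = 0 then 1 else 0) + pO
  · rw [if_pos hr, if_pos (hr.trans threshold_le)]
  · rw [if_neg hr]
    positivity

lemma Config.translate_zero (σ : Config) : Config.translate 0 σ = σ := by
  ext y; simp [Config.translate]

lemma EnvPath.shift_zero_zero (η : EnvPath) : EnvPath.shift 0 0 η = η := by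
  ext t y; simp [EnvPath.shift, Config.translate]

section

variable (pE pO : ℝ) (x : ℤ) (η : EnvPath) (u : ℕ → unitInterval) (n : ℕ)

@[simp] lemma walkFrom_zero : walkFrom pE pO x η u 0 = x := by simp [walkFrom, walk]

lemma walkFrom_succ : walkFrom pE pO x η u (n + 1) =
    walkFrom pE pO x η u n + jump pE pO (η n (walkFrom pE pO x η u n)) (u n) := by
  simp only [walkFrom, walk, jump, EnvPath.shift, Config.translate, add_assoc, add_sub_assoc,
    zero_add]
  rfl

lemma walk_eq_walkFrom : walk pE pO η u n = walkFrom pE pO 0 η u n := by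
  simp [walkFrom, EnvPath.shift_zero_zero]

lemma walkFrom_eq_add_walkFrom_zero :
    walkFrom pE pO x η u n = x + walkFrom pE pO 0 (EnvPath.shift 0 x η) u n := by
  rw [← walk_eq_walkFrom, walkFrom]

lemma walkFrom_add (s : ℕ) : walkFrom pE pO x η u (s + n) =
    walkFrom pE pO (walkFrom pE pO x η u s) (EnvPath.shift s 0 η) (fun k => u (s + k)) n := by
  induction n with
  | zero => simp
  | succ n ih =>
    rw [← add_assoc, walkFrom_succ, walkFrom_succ, ih]
    simp [EnvPath.shift, Config.translate]

lemma abs_walkFrom_sub_le : |walkFrom pE pO x η u n - x| ≤ n := by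
  induction n with
  | zero => simp
  | succ n ih =>
    rw [walkFrom_succ]
    rcases Int.isUnit_iff.mp (isUnit_jump pE pO (η n (walkFrom pE pO x η u n)) (u n)) with h | h <;>
      · rw [h]; push_cast; rw [abs_le] at *; omega

lemma two_dvd_walkFrom_sub : (2 : ℤ) ∣ walkFrom pE pO x η u n - x - n := by
  induction n with
  | zero => simp
  | succ n ih =>
    rw [walkFrom_succ]
    rcases Int.isUnit_iff.mp (isUnit_jump pE pO (η n (walkFrom pE pO x η u n)) (u n)) with h | h <;>
      · rw [h]; push_cast; omega

variable {n} in
lemma abs_walkFrom_sub_walkFrom_le {k : ℕ} (hkn : k ≤ n) :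
    |walkFrom pE pO x η u n - walkFrom pE pO x η u k| ≤ n - k := by
  obtain ⟨m, rfl⟩ := Nat.exists_eq_add_of_le hkn
  simpa only [walkFrom_add, Nat.cast_add, add_sub_cancel_left] using
    abs_walkFrom_sub_le pE pO (walkFrom pE pO x η u k) (EnvPath.shift k 0 η) (fun i => u (k + i)) m

end

lemma walkFrom_congr (pE pO : ℝ) (x : ℤ) {η η' : EnvPath} {u u' : ℕ → unitInterval} {n : ℕ}
    (hη : ∀ k < n, η k = η' k) (hu : ∀ k < n, u k = u' k) :
    walkFrom pE pO x η u n = walkFrom pE pO x η' u' n := by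
  induction n with
  | zero => simp
  | succ n ih =>
    rw [walkFrom_succ, walkFrom_succ,
      ih (fun k hk => hη k (hk.trans n.lt_succ_self)) (fun k hk => hu k (hk.trans n.lt_succ_self)),
      hη n n.lt_succ_self, hu n n.lt_succ_self]

/-- Walks whose starting points have the same parity cannot jump over each other: before crossing
they meet, and there the order of the environments decides. -/
lemma walkFrom_le_walkFrom {pE pO : ℝ} (hp : pE ≤ pO) {x x' : ℤ} (hx : x ≤ x')
    (hpar : (2 : ℤ) ∣ x' - x) {η η' : EnvPath} (u : ℕ → unitInterval) {n : ℕ} {r : ℝ}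
    (hr : |(x : ℝ)| + n ≤ r) (hdom : ∀ s < n, DominatesOn r (η' s) (η s)) :
    walkFrom pE pO x η u n ≤ walkFrom pE pO x' η' u n := by
  induction n with
  | zero => simpa
  | succ n ih =>
    have hr' : |(x : ℝ)| + n ≤ r := by push_cast at hr; linarith
    have ih := ih hr' fun s hs => hdom s (hs.trans n.lt_succ_self)
    rw [walkFrom_succ, walkFrom_succ]
    rcases ih.lt_or_eq with hlt | heq
    · have two_le : walkFrom pE pO x η u n + 2 ≤ walkFrom pE pO x' η' u n := by
        have := two_dvd_walkFrom_sub pE pO x η u n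
        have := two_dvd_walkFrom_sub pE pO x' η' u n
        omega
      have := Int.isUnit_iff.mp (isUnit_jump pE pO (η n (walkFrom pE pO x η u n)) (u n))
      have := Int.isUnit_iff.mp (isUnit_jump pE pO (η' n (walkFrom pE pO x' η' u n)) (u n))
      omega
    · rw [← heq]
      have mem_window : |((walkFrom pE pO x η u n : ℤ) : ℝ)| ≤ r := by
        have hdist : |((walkFrom pE pO x η u n : ℤ) : ℝ) - x| ≤ n := by
          exact_mod_cast abs_walkFrom_sub_le pE pO x η u n
        linarith [abs_sub_abs_le_abs_sub ((walkFrom pE pO x η u n : ℤ) : ℝ) x]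
      have := jump_mono hp (hdom n n.lt_succ_self _ mem_window) (u n)
      omega

/-! ### Measurability -/

section

variable {α : Type*} {m : MeasurableSpace α}

lemma measurable_config_apply {f : α → Config} {g : α → ℤ} (hf : Measurable f)
    (hg : Measurable g) : Measurable fun a => f a (g a) :=
  (measurable_from_prod_countable_left (f := fun p : Config × ℤ => p.1 p.2)
    measurable_pi_apply).comp (hf.prodMk hg)

lemma measurable_jump (pE pO : ℝ) : Measurable fun p : ℕ × unitInterval => jump pE pO p.1 p.2 := by
  refine measurable_from_prod_countable_right fun k => ?_
  have measurable_of_threshold (c : ℝ) :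
      Measurable fun r : unitInterval => 2 * (if (r : ℝ) ≤ c then (1 : ℤ) else 0) - 1 :=
    ((Measurable.ite (measurableSet_le measurable_subtype_coe measurable_const)
      measurable_const measurable_const).const_mul _).sub_const _
  exact measurable_of_threshold ((pE - pO) * (if k = 0 then 1 else 0) + pO)

lemma measurable_walkFrom_of_forall_lt (pE pO : ℝ) {x : α → ℤ} {η : α → EnvPath}
    {u : α → ℕ → unitInterval} (n : ℕ) (hx : Measurable x)
    (hη : ∀ k < n, Measurable fun a => η a k) (hu : ∀ k < n, Measurable fun a => u a k) :
    Measurable fun a => walkFrom pE pO (x a) (η a) (u a) n := by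
  induction n with
  | zero => simpa
  | succ n ih =>
    have ih := ih (fun k hk => hη k (hk.trans n.lt_succ_self))
      (fun k hk => hu k (hk.trans n.lt_succ_self))
    simp only [walkFrom_succ]
    exact ih.add ((measurable_jump pE pO).comp
      ((measurable_config_apply (hη n n.lt_succ_self) ih).prodMk (hu n n.lt_succ_self)))

@[fun_prop]
lemma measurable_walkFrom (pE pO : ℝ) {x : α → ℤ} {η : α → EnvPath} {u : α → ℕ → unitInterval}
    (n : ℕ) (hx : Measurable x) (hη : Measurable η) (hu : Measurable u) :
    Measurable fun a => walkFrom pE pO (x a) (η a) (u a) n :=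
  measurable_walkFrom_of_forall_lt pE pO n hx (fun k _ => (measurable_pi_apply k).comp hη)
    (fun k _ => (measurable_pi_apply k).comp hu)

lemma measurableSet_dominatesOn (r : ℝ) {f g : α → Config} (hf : Measurable f)
    (hg : Measurable g) : MeasurableSet {a | DominatesOn r (f a) (g a)} := by
  simp only [DominatesOn, Set.ofPred_forall]
  exact .iInter fun x => .iInter fun _ =>
    measurableSet_le ((measurable_pi_apply x).comp hg) ((measurable_pi_apply x).comp hf)

end

lemma measurableSet_walkFrom (pE pO : ℝ) (x : ℤ) (u : ℕ → unitInterval) (n : ℕ) (p : ℤ → Prop) :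
    MeasurableSet {η : EnvPath | p (walkFrom pE pO x η u n)} :=
  (measurable_walkFrom pE pO n measurable_const measurable_id measurable_const)
    (.of_discrete (s := {z | p z}))

lemma measurable_walkFrom_piLE (pE pO : ℝ) (x : ℤ) (u : ℕ → unitInterval) (s : ℕ) :
    Measurable[Filtration.piLE (X := fun _ : ℕ => Config) s]
      fun η : EnvPath => walkFrom pE pO x η u s := by
  refine measurable_walkFrom_of_forall_lt (m := Filtration.piLE (X := fun _ : ℕ => Config) s) pE pO
    s measurable_const (fun k hk => ?_) (fun _ _ => measurable_const)
  rw [Filtration.piLE_eq_comap_frestrictLe]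
  exact (measurable_pi_apply (⟨k, Finset.mem_Iic.mpr hk.le⟩ : Finset.Iic s)).comp
    (comap_measurable (Preorder.frestrictLe (π := fun _ : ℕ => Config) s))

@[fun_prop]
lemma measurable_translate (x : ℤ) : Measurable (Config.translate x) :=
  measurable_pi_lambda _ fun y => measurable_pi_apply (x + y)

@[fun_prop]
lemma measurable_shift (s : ℕ) (x : ℤ) : Measurable (EnvPath.shift s x) :=
  measurable_pi_lambda _ fun t => (measurable_translate x).comp (measurable_pi_apply (s + t))

/-! ### Empirical densities -/

/-- `σ` has empirical density `ρ ± ε / 4` on all intervals of length between `l / 2` and `l` with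
left endpoint in `[-r, r]`. The tolerance is such that a configuration with density near `ρ` and
one with density near `ρ + ε` satisfy the hypothesis of the covering condition. -/
def NearDensity (ρ ε : ℝ) (l r : ℕ) (σ : Config) : Prop :=
  ∀ (y : ℤ) (m : ℕ), |y| ≤ r → l / 2 ≤ m → m ≤ l → |(σ.mass y m : ℝ) - ρ * m| ≤ ε / 4 * m

lemma measurable_abs_mass_sub (y : ℤ) (m : ℕ) (z : ℝ) :
    Measurable fun σ : Config => |(σ.mass y m : ℝ) - z| := by
  have measurable_mass : Measurable fun σ : Config => σ.mass y m :=
    Finset.measurable_sum _ fun x _ => measurable_pi_apply x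
  exact measurable_norm.comp
    (((measurable_from_top (f := fun k : ℕ => (k : ℝ))).comp measurable_mass).sub_const z)

lemma measurableSet_nearDensity (ρ ε : ℝ) (l r : ℕ) :
    MeasurableSet {σ | NearDensity ρ ε l r σ} := by
  simp only [NearDensity, Set.ofPred_forall]
  exact .iInter fun y => .iInter fun m => .iInter fun _ => .iInter fun _ => .iInter fun _ =>
    measurableSet_le (measurable_abs_mass_sub y m _) measurable_const

lemma Config.mass_translate (σ : Config) (x y : ℤ) (m : ℕ) :
    (Config.translate x σ).mass y m = σ.mass (x + y) m := by
  simp only [Config.mass, Config.translate, add_assoc, ← Finset.image_add_left_Ico,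
    Finset.sum_image (add_right_injective x).injOn]

lemma NearDensity.translate {ρ ε : ℝ} {l r r' : ℕ} {σ : Config} (h : NearDensity ρ ε l r' σ)
    (x : ℤ) (hx : |x| + r ≤ r') : NearDensity ρ ε l r (Config.translate x σ) := by
  intro y m hy hlm hml
  rw [Config.mass_translate]
  exact h _ m (by linarith [abs_add_le x y]) hlm hml

/-! ### Splitting a sequence of i.i.d. variables -/

/-- The first `s` terms of `u`, followed by the sequence `v`. It is used to restart the walk with
fresh driving variables. -/
def concatAt {β : Type*} (s : ℕ) (u v : ℕ → β) : ℕ → β := fun n => if n < s then u n else v (n - s)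

section

variable {β : Type*}

lemma concatAt_of_lt {s k : ℕ} (hk : k < s) (u v : ℕ → β) : concatAt s u v k = u k := if_pos hk

lemma concatAt_add (s : ℕ) (u v : ℕ → β) : (fun k => concatAt s u v (s + k)) = v := by
  ext k; simp [concatAt]

lemma concatAt_preimage_pi (s : ℕ) (I : Finset ℕ) (t : ℕ → Set β) :
    (fun p : (ℕ → β) × (ℕ → β) => concatAt s p.1 p.2) ⁻¹' Set.pi I t =
      Set.pi (I.filter (· < s)) t ×ˢ
        Set.pi ((I.filter (¬ · < s)).image (· - s)) fun k => t (s + k) := by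
  ext p
  simp only [Set.mem_preimage, Set.mem_pi, Set.mem_prod, Finset.mem_coe, Finset.mem_filter,
    Finset.mem_image, concatAt]
  constructor
  · refine fun h => ⟨fun i hi => by simpa only [if_pos hi.2] using h i hi.1, ?_⟩
    rintro _ ⟨i, ⟨hi, his⟩, rfl⟩
    simpa only [if_neg his, Nat.add_sub_cancel' (not_lt.mp his)] using h i hi
  · rintro ⟨h_lt, h_ge⟩ i hi
    split_ifs with his
    · exact h_lt i ⟨hi, his⟩
    · simpa only [Nat.add_sub_cancel' (not_lt.mp his)] using h_ge (i - s) ⟨i, ⟨hi, his⟩, rfl⟩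

variable [MeasurableSpace β]

lemma measurable_concatAt (s : ℕ) :
    Measurable fun p : (ℕ → β) × (ℕ → β) => concatAt s p.1 p.2 := by
  refine measurable_pi_lambda _ fun n => ?_
  unfold concatAt
  split_ifs <;> fun_prop

lemma map_concatAt (P : Measure β) [IsProbabilityMeasure P] (s : ℕ) :
    ((Measure.infinitePi fun _ : ℕ => P).prod (Measure.infinitePi fun _ : ℕ => P)).map
      (fun p => concatAt s p.1 p.2) = Measure.infinitePi fun _ : ℕ => P := by
  refine Measure.eq_infinitePi _ fun I t ht => ?_
  rw [Measure.map_apply (measurable_concatAt s) (.pi I.countable_toSet fun i _ => ht i),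
    concatAt_preimage_pi, Measure.prod_prod, Measure.infinitePi_pi _ fun i _ => ht i,
    Measure.infinitePi_pi _ fun i _ => ht _, Finset.prod_image,
    ← Finset.prod_filter_mul_prod_filter_not I (· < s)]
  · congr 1
    refine Finset.prod_congr rfl fun i hi => ?_
    rw [Nat.add_sub_cancel' (not_lt.mp (Finset.mem_filter.mp hi).2)]
  · intro i hi j hj hij
    have := (Finset.mem_filter.mp hi).2
    have := (Finset.mem_filter.mp hj).2
    dsimp only at hij
    omega

end

/-! ### Couplings and exceptional sets -/

lemma measure_compl_le_measure_compl_add {α β : Type*} [MeasurableSpace α] [MeasurableSpace β]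
    {P : Measure α} {P' : Measure β} [IsProbabilityMeasure P] [IsProbabilityMeasure P']
    {A : Set α} {A' : Set β} (hA : MeasurableSet A) (hA' : MeasurableSet A') {e : ℝ≥0∞}
    (h : P A ≤ P' A' + e) : P' A'ᶜ ≤ P Aᶜ + e := by
  rw [prob_compl_eq_one_sub hA, prob_compl_eq_one_sub hA', tsub_le_iff_right]
  calc 1 ≤ 1 - P A + P A := le_tsub_add
    _ ≤ 1 - P A + (P' A' + e) := by gcongr
    _ = 1 - P A + e + P' A' := by ring

lemma lintegral_le_lintegral_add_measure {α : Type*} [MeasurableSpace α] {Q : Measure α}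
    [IsProbabilityMeasure Q] {f g : α → ℝ≥0∞} {B : Set α} {e : ℝ≥0∞} (hg : Measurable g)
    (hf : ∀ a, f a ≤ 1) (h : ∀ a ∉ B, f a ≤ g a + e) :
    ∫⁻ a, f a ∂Q ≤ ∫⁻ a, g a ∂Q + e + Q B := by
  calc ∫⁻ a, f a ∂Q ≤ ∫⁻ a, (g a + e + B.indicator (fun _ => 1) a) ∂Q := by
        refine lintegral_mono fun a => ?_
        by_cases ha : a ∈ B
        · rw [Set.indicator_of_mem ha]
          exact (hf a).trans le_add_self
        · simpa only [Set.indicator_of_notMem ha, add_zero] using h a ha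
    _ ≤ ∫⁻ a, g a ∂Q + e + Q B := by
        rw [lintegral_add_left (hg.add_const e), lintegral_add_left hg, lintegral_const,
          measure_univ, mul_one]
        gcongr
        simpa only [one_mul] using lintegral_indicator_const_le B 1

namespace IsCoupling

variable {α : Type*} [MeasurableSpace α] {Q : Measure (α × α)} {P P' : Measure α}

lemma isProbabilityMeasure [IsProbabilityMeasure P] (h : IsCoupling Q P P') :
    IsProbabilityMeasure Q := by
  have : IsProbabilityMeasure (Q.map Prod.fst) := by rwa [h.1]
  exact Measure.isProbabilityMeasure_of_map Prod.fst

lemma lintegral_fst (h : IsCoupling Q P P') {f : α → ℝ≥0∞} (hf : Measurable f) :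
    ∫⁻ a, f a ∂P = ∫⁻ ω, f ω.1 ∂Q := by
  rw [← h.1, lintegral_map hf measurable_fst]

lemma lintegral_snd (h : IsCoupling Q P P') {f : α → ℝ≥0∞} (hf : Measurable f) :
    ∫⁻ a, f a ∂P' = ∫⁻ ω, f ω.2 ∂Q := by
  rw [← h.2, lintegral_map hf measurable_snd]

lemma lintegral_le (h : IsCoupling Q P P') {f g : α → ℝ≥0∞} (hf : Measurable f)
    (hg : Measurable g) (hgf : ∀ᵐ ω ∂Q, g ω.2 ≤ f ω.1) : ∫⁻ a, g a ∂P' ≤ ∫⁻ a, f a ∂P := by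
  rw [h.lintegral_fst hf, h.lintegral_snd hg]
  exact lintegral_mono_ae hgf

lemma lintegral_le_add [IsProbabilityMeasure P] (h : IsCoupling Q P P') {f g : α → ℝ≥0∞}
    (hf : Measurable f) (hg : Measurable g) (hg_one : ∀ a, g a ≤ 1) {B : Set (α × α)} {e : ℝ≥0∞}
    (hgf : ∀ ω ∉ B, g ω.2 ≤ f ω.1 + e) : ∫⁻ a, g a ∂P' ≤ ∫⁻ a, f a ∂P + e + Q B := by
  have := h.isProbabilityMeasure
  rw [h.lintegral_fst hf, h.lintegral_snd hg]
  exact lintegral_le_lintegral_add_measure (hf.comp measurable_fst) (fun ω => hg_one ω.2) hgf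

lemma measure_le_add [IsProbabilityMeasure P] (h : IsCoupling Q P P') {A A' : Set α}
    (hA : MeasurableSet A) (hA' : MeasurableSet A') {B : Set (α × α)}
    (hAA' : ∀ ω ∉ B, ω.2 ∈ A' → ω.1 ∈ A) : P' A' ≤ P A + Q B := by
  have hle := h.lintegral_le_add (e := 0) (measurable_one.indicator hA)
    (measurable_one.indicator hA') (Set.indicator_le_self' fun _ _ => zero_le_one)
    (B := B) fun ω hω => by
      by_cases hω' : ω.2 ∈ A'
      · simp [hω', hAA' ω hω hω']
      · simp [hω']
  simpa only [lintegral_indicator_one hA, lintegral_indicator_one hA', add_zero] using hle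

lemma measure_compl_le [IsProbabilityMeasure P] (h : IsCoupling Q P P') {A : Set (α × α)}
    (hA : MeasurableSet A) {x : ℝ} (hx : 1 - x ≤ Q.real A) : Q Aᶜ ≤ ENNReal.ofReal x := by
  have := h.isProbabilityMeasure
  rw [← ofReal_measureReal, probReal_compl_eq_one_sub hA]
  exact ENNReal.ofReal_le_ofReal (by linarith)

end IsCoupling

/-! ### Markov property, translations and monotonicity -/

namespace Environment

variable {a b : ℝ} (E : Environment a b)

lemma measure_translate (σ : Config) (x : ℤ) {A : Set EnvPath} (hA : MeasurableSet A) :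
    E.P (Config.translate x σ) A = E.P σ {η | EnvPath.shift 0 x η ∈ A} := by
  have hmarkov := E.markov σ 0 x A Set.univ hA MeasurableSet.univ
  rw [Set.univ_inter, Measure.restrict_univ] at hmarkov
  calc E.P (Config.translate x σ) A = ∫⁻ _, E.P (Config.translate x σ) A ∂(E.P σ) := by simp
    _ = ∫⁻ η, E.P (Config.translate x (η 0)) A ∂(E.P σ) := by
        refine lintegral_congr_ae ?_
        filter_upwards [E.start σ] with η hη
        rw [hη]
    _ = _ := hmarkov.symm

lemma measure_shift_mem (σ : Config) (s : ℕ) {N : EnvPath → ℤ}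
    (hN : Measurable[Filtration.piLE (X := fun _ : ℕ => Config) s] N) {A : ℤ → Set EnvPath}
    (hA : ∀ y, MeasurableSet (A y)) :
    E.P σ {η | EnvPath.shift s 0 η ∈ A (N η)} = ∫⁻ η, E.P (η s) (A (N η)) ∂(E.P σ) := by
  have hpast (y : ℤ) : MeasurableSet[Filtration.piLE (X := fun _ : ℕ => Config) s] (N ⁻¹' {y}) :=
    hN (measurableSet_singleton y)
  have hmeas (y : ℤ) : MeasurableSet (N ⁻¹' {y}) :=
    (Filtration.piLE (X := fun _ : ℕ => Config)).le s _ (hpast y)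
  have hdisj : Pairwise (Function.onFun Disjoint fun y : ℤ => N ⁻¹' {y}) := fun y z hyz =>
    Disjoint.preimage N (Set.disjoint_singleton.mpr hyz)
  have event_eq : {η | EnvPath.shift s 0 η ∈ A (N η)} =
      ⋃ y, (N ⁻¹' {y} ∩ EnvPath.shift s 0 ⁻¹' A y) := by
    ext η; simp
  have cover : (⋃ y, N ⁻¹' {y}) = Set.univ := by ext η; simp
  rw [event_eq, measure_iUnion (fun y z hyz => (hdisj hyz).mono Set.inter_subset_left
      Set.inter_subset_left) (fun y => (hmeas y).inter (measurable_shift s 0 (hA y))),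
    ← setLIntegral_univ, ← cover, lintegral_iUnion hmeas hdisj]
  refine tsum_congr fun y => ?_
  rw [E.markov σ s 0 (A y) _ (hA y) (hpast y)]
  refine setLIntegral_congr_fun (hmeas y) fun η hη => ?_
  simp only [Config.translate_zero, Set.mem_singleton_iff.mp hη]

lemma law_apply (ρ : ℝ) {A : Set EnvPath} (hA : MeasurableSet A) :
    E.law ρ A = ∫⁻ σ, E.P σ A ∂(E.μ ρ : Measure Config) :=
  Measure.bind_apply hA E.P.measurable.aemeasurable

lemma lintegral_law (ρ : ℝ) {f : EnvPath → ℝ≥0∞} (hf : Measurable f) :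
    ∫⁻ η, f η ∂(E.law ρ) = ∫⁻ σ, ∫⁻ η, f η ∂(E.P σ) ∂(E.μ ρ : Measure Config) :=
  Measure.lintegral_bind E.P.measurable.aemeasurable hf.aemeasurable

lemma measurable_measure_apply {α : Type*} [MeasurableSpace α] {f : α → Config} {g : α → ℤ}
    (hf : Measurable f) (hg : Measurable g) {A : ℤ → Set EnvPath} (hA : ∀ y, MeasurableSet (A y)) :
    Measurable fun x => E.P (f x) (A (g x)) :=
  (measurable_from_prod_countable_left (f := fun p : Config × ℤ => E.P p.1 (A p.2))
    fun y => E.P.measurable_coe (hA y)).comp (hf.prodMk hg)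

section

variable (pE pO : ℝ) (x : ℤ) (u : ℕ → unitInterval) (s n : ℕ) (p : ℤ → Prop)

lemma measure_walkFrom_add (σ : Config) :
    E.P σ {η | p (walkFrom pE pO x η u (s + n))} =
      ∫⁻ η, E.P (η s) {ζ | p (walkFrom pE pO (walkFrom pE pO x η u s) ζ (fun k => u (s + k)) n)}
        ∂(E.P σ) := by
  rw [← E.measure_shift_mem σ s (measurable_walkFrom_piLE pE pO x u s)
    (A := fun y => {ζ | p (walkFrom pE pO y ζ (fun k => u (s + k)) n)})
    (fun y => measurableSet_walkFrom pE pO y _ n p)]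
  simp only [walkFrom_add, Set.mem_ofPred_eq]

lemma law_walkFrom_add (ρ : ℝ) :
    E.law ρ {η | p (walkFrom pE pO x η u (s + n))} =
      ∫⁻ η, E.P (η s) {ζ | p (walkFrom pE pO (walkFrom pE pO x η u s) ζ (fun k => u (s + k)) n)}
        ∂(E.law ρ) := by
  have hmeas : Measurable fun η : EnvPath =>
      E.P (η s) {ζ | p (walkFrom pE pO (walkFrom pE pO x η u s) ζ (fun k => u (s + k)) n)} :=
    E.measurable_measure_apply (A := fun y => {ζ | p (walkFrom pE pO y ζ (fun k => u (s + k)) n)})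
      (measurable_pi_apply s)
      (measurable_walkFrom pE pO s measurable_const measurable_id measurable_const)
      fun y => measurableSet_walkFrom pE pO y _ n p
  rw [E.law_apply ρ (measurableSet_walkFrom pE pO x u _ p), E.lintegral_law ρ hmeas]
  exact lintegral_congr (E.measure_walkFrom_add pE pO x u s n p)

lemma measure_walkFrom_eq_translate (σ : Config) :
    E.P σ {η | p (walkFrom pE pO x η u n)} =
      E.P (Config.translate x σ) {η | p (x + walkFrom pE pO 0 η u n)} := by
  rw [E.measure_translate σ x (measurableSet_walkFrom pE pO 0 u n fun z => p (x + z))]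
  simp only [walkFrom_eq_add_walkFrom_zero pE pO x, Set.mem_ofPred_eq]

lemma law_walkFrom_eq {ρ : ℝ} (hρ : ρ ∈ Set.Ioo a b) :
    E.law ρ {η | p (walkFrom pE pO x η u n)} = E.law ρ {η | p (x + walkFrom pE pO 0 η u n)} := by
  have hmeas := measurableSet_walkFrom pE pO 0 u n fun z => p (x + z)
  rw [E.law_apply ρ (measurableSet_walkFrom pE pO x u n p), E.law_apply ρ hmeas]
  simp only [E.measure_walkFrom_eq_translate pE pO x u n p]
  nth_rewrite 2 [← E.translation_invariant ρ hρ x]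
  rw [lintegral_map (E.P.measurable_coe hmeas) (measurable_translate x)]

end

lemma law_apply_zero (ρ : ℝ) {A : Set Config} (hA : MeasurableSet A) :
    E.law ρ {η | η 0 ∈ A} = (E.μ ρ : Measure Config) A := by
  have hmeas : MeasurableSet {η : EnvPath | η 0 ∈ A} := measurable_pi_apply 0 hA
  rw [E.law_apply ρ hmeas, ← lintegral_indicator_one hA]
  refine lintegral_congr fun σ => ?_
  have start_iff : {η : EnvPath | η 0 ∈ A} =ᵐ[E.P σ] {_η : EnvPath | σ ∈ A} := by
    filter_upwards [E.start σ] with η hη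
    exact congrArg (· ∈ A) hη
  rw [measure_congr start_iff]
  by_cases h : σ ∈ A <;> simp [h]

lemma law_apply_time {ρ : ℝ} (hρ : ρ ∈ Set.Ioo a b) (s : ℕ) {A : Set Config}
    (hA : MeasurableSet A) : E.law ρ {η | η s ∈ A} = (E.μ ρ : Measure Config) A := by
  have hstat : (E.law ρ).map (EnvPath.shift s 0) = E.law ρ := E.stationary ρ hρ s
  have hmeas : MeasurableSet {η : EnvPath | η 0 ∈ A} := measurable_pi_apply 0 hA
  rw [← E.law_apply_zero ρ hA]
  nth_rewrite 2 [← hstat]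
  rw [Measure.map_apply (measurable_shift s 0) hmeas]
  simp [EnvPath.shift, Config.translate_zero]

lemma lintegral_law_mono {ρ ρ' : ℝ} (hρ : ρ ∈ Set.Ioo a b) (hρ' : ρ' ∈ Set.Ioo a b) (hle : ρ' ≤ ρ)
    {f : EnvPath → ℝ≥0∞} (hf : Measurable f) (hmono : Monotone f) :
    ∫⁻ η, f η ∂(E.law ρ') ≤ ∫⁻ η, f η ∂(E.law ρ) := by
  rw [E.lintegral_law ρ hf, E.lintegral_law ρ' hf]
  obtain ⟨Q, hQ, hle_ae⟩ := E.monotone_density ρ hρ ρ' hρ' hle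
  have hint : Measurable fun σ => ∫⁻ η, f η ∂(E.P σ) := hf.lintegral_kernel
  refine hQ.lintegral_le hint hint (hle_ae.mono fun ω hω => ?_)
  obtain ⟨Q', hQ', hle_ae'⟩ := E.monotone_quenched ω.1 ω.2 hω
  exact hQ'.lintegral_le hf hf (hle_ae'.mono fun ω' hω' => hmono hω')

variable {E}

lemma NoDriftIn.exists_isCoupling {ν : ℝ} (hdrift : E.NoDriftIn ν) {n H : ℕ} {ξ ξ' : Config}
    (h : DominatesOn H ξ ξ') : ∃ Q : Measure (EnvPath × EnvPath),
      IsCoupling Q (E.P ξ) (E.P ξ') ∧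
      Q {ω | ∀ s ≤ n, DominatesOn (H - 2 * ν * n) (ω.1 s) (ω.2 s)}ᶜ ≤
        ENNReal.ofReal (20 * Real.exp (-(ν * n / 4))) := by
  obtain ⟨Q, hQ, hle⟩ := hdrift n H 1 le_rfl ξ ξ' h
  simp only [Nat.cast_one, mul_one, one_mul] at hle
  refine ⟨Q, hQ, hQ.measure_compl_le ?_ hle⟩
  simp only [Set.ofPred_forall]
  exact .iInter fun s => .iInter fun _ => measurableSet_dominatesOn _
    ((measurable_pi_apply s).comp measurable_fst) ((measurable_pi_apply s).comp measurable_snd)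

lemma measure_walkFrom_le_of_dominatesOn {ν : ℝ} (hdrift : E.NoDriftIn ν) {pE pO : ℝ}
    (hp : pE ≤ pO) {n H : ℕ} {ξ ξ' : Config} (h : DominatesOn H ξ ξ') {x : ℤ}
    (hx : |(x : ℝ)| + n + 2 * ν * n ≤ H) (u : ℕ → unitInterval) (c : ℤ) :
    E.P ξ' {η | c ≤ walkFrom pE pO x η u n} ≤
      E.P ξ {η | c ≤ walkFrom pE pO x η u n} +
        ENNReal.ofReal (20 * Real.exp (-(ν * n / 4))) := by
  obtain ⟨Q, hQ, hQ_le⟩ := hdrift.exists_isCoupling (n := n) h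
  have hmeas := measurableSet_walkFrom pE pO x u n fun z => c ≤ z
  refine (hQ.measure_le_add hmeas hmeas fun ω hω hc => ?_).trans (by gcongr)
  exact le_trans hc (walkFrom_le_walkFrom hp le_rfl (by simp) u (r := H - 2 * ν * n)
    (by linarith) fun s hs => not_not.mp hω s hs.le)

/-- A lead of `2 t` protects the upper walk against everything that happens before the covering
time `t`. -/
lemma measure_walkFrom_le_of_covered {ν : ℝ} (hdrift : E.NoDriftIn ν) {pE pO : ℝ} (hp : pE ≤ pO)
    {σ τ : Config} {t n H : ℕ} {Q : Measure (EnvPath × EnvPath)} (hQ : IsCoupling Q (E.P τ) (E.P σ))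
    {e : ℝ≥0∞} (hQ_le : Q {ω | DominatesOn H (ω.1 t) (ω.2 t)}ᶜ ≤ e) {x : ℤ}
    (hx : |((x + t : ℤ) : ℝ)| + n + 2 * ν * n ≤ H) (u : ℕ → unitInterval) (c : ℤ) :
    E.P σ {η | c ≤ walkFrom pE pO x η u (t + n)} ≤
      E.P τ {η | c ≤ walkFrom pE pO (x + 2 * t) η u (t + n)} +
        (ENNReal.ofReal (20 * Real.exp (-(ν * n / 4))) + e) := by
  set Φ : Config → ℤ → ℝ≥0∞ :=
    fun ξ y => E.P ξ {ζ | c ≤ walkFrom pE pO y ζ (fun k => u (t + k)) n}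
  have hΦ : Measurable fun η : EnvPath => Φ (η t) (x + t) :=
    (E.P.measurable_coe (measurableSet_walkFrom pE pO _ _ n fun z => c ≤ z)).comp
      (measurable_pi_apply t)
  have Φ_mono (ξ : Config) {y y' : ℤ} (hy : y ≤ y') (hpar : (2 : ℤ) ∣ y' - y) : Φ ξ y ≤ Φ ξ y' :=
    measure_mono fun ζ (hζ : c ≤ _) =>
      hζ.trans (walkFrom_le_walkFrom hp hy hpar _ le_rfl fun _ _ _ _ => le_rfl)
  rw [measure_walkFrom_add, measure_walkFrom_add, ← add_assoc]
  calc ∫⁻ η, Φ (η t) (walkFrom pE pO x η u t) ∂(E.P σ)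
      ≤ ∫⁻ η, Φ (η t) (x + t) ∂(E.P σ) := by
        refine lintegral_mono fun η => Φ_mono _ ?_ ?_
        · linarith [(abs_le.mp (abs_walkFrom_sub_le pE pO x η u t)).2]
        · have := two_dvd_walkFrom_sub pE pO x η u t; omega
    _ ≤ ∫⁻ η, Φ (η t) (x + t) ∂(E.P τ) + ENNReal.ofReal (20 * Real.exp (-(ν * n / 4))) +
          Q {ω | DominatesOn H (ω.1 t) (ω.2 t)}ᶜ :=
        hQ.lintegral_le_add hΦ hΦ (fun _ => prob_le_one) fun ω hω =>
          measure_walkFrom_le_of_dominatesOn hdrift hp (not_not.mp hω) hx _ c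
    _ ≤ ∫⁻ η, Φ (η t) (walkFrom pE pO (x + 2 * t) η u t) ∂(E.P τ) +
          ENNReal.ofReal (20 * Real.exp (-(ν * n / 4))) + e := by
        gcongr with η
        refine Φ_mono _ ?_ ?_
        · linarith [(abs_le.mp (abs_walkFrom_sub_le pE pO (x + 2 * t) η u t)).1]
        · have := two_dvd_walkFrom_sub pE pO (x + 2 * t) η u t; omega

end Environment

/-! ### Scales -/

/-- The length of the intervals on which the empirical density of the environment is controlled in
a block of length `L`. -/
noncomputable def densityScale (L : ℕ) : ℕ := ⌊(L : ℝ) ^ (1 / 8 : ℝ)⌋₊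

/-- The part of a block of length `L` which is sacrificed to the covering of one environment by
another. The covering condition at this time `t` involves intervals of length
`t ^ (1 / 4) = densityScale L`. -/
noncomputable def coveringTime (L : ℕ) : ℕ := densityScale L ^ 4

/-- The radius around the walker within which the density of the environment is controlled at the
start of a block of length `L`, when the activity rate is `ν`. -/
noncomputable def blockWindow (ν : ℝ) (L : ℕ) : ℕ := ⌈(6 * ν + 2) * L⌉₊

lemma tendsto_densityScale : Tendsto densityScale atTop atTop :=
  tendsto_nat_floor_atTop.comp
    ((tendsto_rpow_atTop (by norm_num)).comp tendsto_natCast_atTop_atTop)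

lemma densityScale_pow_eight_le (L : ℕ) : densityScale L ^ 8 ≤ L := by
  have floor_le : (densityScale L : ℝ) ≤ (L : ℝ) ^ (1 / 8 : ℝ) := Nat.floor_le (by positivity)
  have pow_eq : ((L : ℝ) ^ (1 / 8 : ℝ)) ^ 8 = L := by
    rw [← Real.rpow_mul_natCast (by positivity)]
    norm_num
  exact_mod_cast (pow_le_pow_left₀ (by positivity) floor_le 8).trans_eq pow_eq

lemma densityScale_le (L : ℕ) : densityScale L ≤ L :=
  (Nat.le_self_pow (by norm_num) _).trans (densityScale_pow_eight_le L)

lemma rpow_le_two_mul_densityScale {L : ℕ} (hL : 1 ≤ L) :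
    (L : ℝ) ^ (1 / 8 : ℝ) ≤ 2 * densityScale L := by
  have one_le : (1 : ℝ) ≤ densityScale L := by
    exact_mod_cast Nat.le_floor
      (by simpa using Real.one_le_rpow (Nat.one_le_cast.mpr hL) (by norm_num))
  linarith [Nat.lt_floor_add_one ((L : ℝ) ^ (1 / 8 : ℝ)), show
    (densityScale L : ℝ) = ⌊(L : ℝ) ^ (1 / 8 : ℝ)⌋₊ from rfl]

lemma coveringTime_sq_le (L : ℕ) : coveringTime L ^ 2 ≤ L := by
  rw [coveringTime, ← pow_mul]
  exact densityScale_pow_eight_le L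

lemma coveringTime_le (L : ℕ) : coveringTime L ≤ L :=
  (Nat.le_self_pow two_ne_zero _).trans (coveringTime_sq_le L)

lemma two_mul_coveringTime_le {L : ℕ} (hL : 2 ≤ L) : 2 * coveringTime L ≤ L := by
  nlinarith [coveringTime_sq_le L, Nat.le_self_pow two_ne_zero (coveringTime L)]

lemma coveringTime_rpow (L : ℕ) : (coveringTime L : ℝ) ^ (1 / 4 : ℝ) = densityScale L := by
  rw [coveringTime, Nat.cast_pow, ← Real.rpow_natCast,
    ← Real.rpow_mul (by positivity)]
  norm_num

lemma blockWindow_le {ν : ℝ} (hν : 0 ≤ ν) {L : ℕ} (hL : 1 ≤ L) :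
    (blockWindow ν L : ℝ) ≤ (6 * ν + 3) * L := by
  have : (1 : ℝ) ≤ L := Nat.one_le_cast.mpr hL
  linarith [(Nat.ceil_lt_add_one (a := (6 * ν + 2) * L) (by positivity)).le, show
    (blockWindow ν L : ℝ) = ⌈(6 * ν + 2) * L⌉₊ from rfl]

lemma ceil_le_blockWindow_sub {ν : ℝ} (hν : 0 ≤ ν) {L : ℕ} (hL : 1 ≤ L) :
    (⌈(2 * ν + 1) * L⌉₊ : ℝ) ≤ blockWindow ν L - 4 * ν * coveringTime L := by
  have hL' : (1 : ℝ) ≤ L := Nat.one_le_cast.mpr hL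
  have le_window : (6 * ν + 2) * L ≤ blockWindow ν L := Nat.le_ceil _
  have : 4 * ν * coveringTime L ≤ 4 * ν * L := by
    gcongr
    exact coveringTime_le L
  linarith [(Nat.ceil_lt_add_one (a := (2 * ν + 1) * L) (by positivity)).le]

lemma rpow_le_sq_mul_densityScale {L : ℕ} (hL : 1 ≤ L) {ε : ℝ}
    (hε : (L : ℝ) ^ (-(1 / 32) : ℝ) ≤ ε) :
    (L : ℝ) ^ (1 / 16 : ℝ) / 2 ≤ ε ^ 2 * densityScale L := by
  have hL' : (0 : ℝ) < L := by positivity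
  calc (L : ℝ) ^ (1 / 16 : ℝ) / 2
      = ((L : ℝ) ^ (-(1 / 32) : ℝ)) ^ 2 * ((L : ℝ) ^ (1 / 8 : ℝ) / 2) := by
        rw [← Real.rpow_mul_natCast hL'.le, ← mul_div_assoc, ← Real.rpow_add hL']
        norm_num
    _ ≤ ε ^ 2 * densityScale L := by
        gcongr
        linarith [rpow_le_two_mul_densityScale hL]

lemma isLittleO_rpow_rpow_natCast {p q : ℝ} (hqp : q < p) :
    (fun L : ℕ => (L : ℝ) ^ q) =o[atTop] fun L : ℕ => (L : ℝ) ^ p := by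
  have tendsto_ratio : Tendsto (fun L : ℕ => (L : ℝ) ^ (-(p - q))) atTop (𝓝 0) :=
    (tendsto_rpow_neg_atTop (sub_pos.mpr hqp)).comp tendsto_natCast_atTop_atTop
  have eventually_pos : ∀ᶠ L : ℕ in atTop, (0 : ℝ) < L :=
    (eventually_gt_atTop 0).mono fun L hL => Nat.cast_pos.mpr hL
  refine (Asymptotics.isLittleO_iff_tendsto' ?_).mpr (tendsto_ratio.congr' ?_)
  · exact eventually_pos.mono fun L hL h => absurd h (Real.rpow_pos_of_pos hL p).ne'
  · exact eventually_pos.mono fun L hL => by simp only [neg_sub, Real.rpow_sub hL]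

lemma eventually_mul_pow_mul_exp_neg_rpow_le (K : ℝ) (k : ℕ) {κ p q : ℝ} (hκ : 0 < κ) (hq : 0 < q)
    (hqp : q < p) : ∀ᶠ L : ℕ in atTop,
      K * L ^ k * Real.exp (-(κ * L ^ p)) ≤ Real.exp (-(L : ℝ) ^ q) := by
  have exponent_isLittleO : (fun L : ℕ => Real.log (|K| + 1) + k * Real.log L + (L : ℝ) ^ q)
      =o[atTop] fun L : ℕ => (L : ℝ) ^ p := by
    have tendsto_rpow : Tendsto (fun L : ℕ => (L : ℝ) ^ p) atTop atTop :=
      (tendsto_rpow_atTop (hq.trans hqp)).comp tendsto_natCast_atTop_atTop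
    refine .add (.add ?_ (.const_mul_left ?_ _)) (isLittleO_rpow_rpow_natCast hqp)
    · exact Asymptotics.isLittleO_const_left.mpr (.inr (tendsto_norm_atTop_atTop.comp tendsto_rpow))
    · exact (isLittleO_log_rpow_atTop (hq.trans hqp)).comp_tendsto tendsto_natCast_atTop_atTop
  filter_upwards [exponent_isLittleO.bound hκ, eventually_gt_atTop 0] with L hL hL0
  have hL' : (0 : ℝ) < L := by exact_mod_cast hL0
  rw [Real.norm_of_nonneg (Real.rpow_nonneg hL'.le p)] at hL
  calc K * L ^ k * Real.exp (-(κ * L ^ p))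
      ≤ (|K| + 1) * L ^ k * Real.exp (-(κ * L ^ p)) := by
        gcongr
        linarith [le_abs_self K]
    _ = Real.exp (Real.log (|K| + 1) + k * Real.log L - κ * L ^ p) := by
        rw [sub_eq_add_neg, Real.exp_add, Real.exp_add, Real.exp_log (by positivity),
          Real.exp_nat_mul, Real.exp_log hL']
    _ ≤ Real.exp (-(L : ℝ) ^ q) := by
        gcongr
        linarith [(le_abs_self _).trans hL]

lemma isLittleO_mul_one_add_add_log_pow (K c : ℝ) :
    (fun L : ℕ => K * (1 + (c + Real.log L) ^ 3))
      =o[atTop] fun L : ℕ => (L : ℝ) ^ (1 / 16 : ℝ) := by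
  have tendsto_rpow {p : ℝ} (hp : 0 < p) : Tendsto (fun L : ℕ => ‖(L : ℝ) ^ p‖) atTop atTop :=
    tendsto_norm_atTop_atTop.comp ((tendsto_rpow_atTop hp).comp tendsto_natCast_atTop_atTop)
  have add_log_isLittleO : (fun L : ℕ => c + Real.log L)
      =o[atTop] fun L : ℕ => (L : ℝ) ^ (1 / 48 : ℝ) :=
    (Asymptotics.isLittleO_const_left.mpr (.inr (tendsto_rpow (by norm_num)))).add
      ((isLittleO_log_rpow_atTop (by norm_num)).comp_tendsto tendsto_natCast_atTop_atTop)
  refine .const_mul_left (.add (Asymptotics.isLittleO_const_left.mpr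
    (.inr (tendsto_rpow (by norm_num)))) ((add_log_isLittleO.pow three_pos).congr_right ?_)) _
  intro L
  rw [← Real.rpow_mul_natCast (by positivity)]
  norm_num

lemma eventually_mul_inv_sq_mul_log_lt {ν : ℝ} (hν : 0 < ν) {C : ℝ} (hC : 0 ≤ C) :
    ∀ᶠ L : ℕ in atTop, ∀ ε, (L : ℝ) ^ (-(1 / 32) : ℝ) ≤ ε →
      C * (ε ^ 2)⁻¹ * (1 + |Real.log (ν * coveringTime L) ^ 3|) < ν * densityScale L := by
  filter_upwards [(isLittleO_mul_one_add_add_log_pow (2 * C) |Real.log ν|).bound (half_pos hν),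
    eventually_ge_atTop 1,
    tendsto_densityScale.eventually_ge_atTop 1] with L hL hL1 hscale ε hε
  have hL' : (1 : ℝ) ≤ L := Nat.one_le_cast.mpr hL1
  have hε0 : 0 < ε := lt_of_lt_of_le (by positivity) hε
  have ht : (1 : ℝ) ≤ coveringTime L := Nat.one_le_cast.mpr (Nat.one_le_pow _ _ hscale)
  have htL : (coveringTime L : ℝ) ≤ L := Nat.cast_le.mpr (coveringTime_le L)
  have abs_log_le : |Real.log (ν * coveringTime L) ^ 3| ≤ (|Real.log ν| + Real.log L) ^ 3 := by
    rw [abs_pow, Real.log_mul hν.ne' (by positivity)]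
    gcongr
    refine (abs_add_le _ _).trans ?_
    rw [abs_of_nonneg (Real.log_nonneg ht)]
    gcongr
  have inv_le : (ε ^ 2)⁻¹ * (L : ℝ) ^ (1 / 16 : ℝ) ≤ 2 * densityScale L := by
    rw [inv_mul_le_iff₀ (by positivity)]
    linarith [rpow_le_sq_mul_densityScale hL1 hε]
  rw [Real.norm_of_nonneg (Real.rpow_nonneg (by positivity) _)] at hL
  calc C * (ε ^ 2)⁻¹ * (1 + |Real.log (ν * coveringTime L) ^ 3|)
      ≤ C * (ε ^ 2)⁻¹ * (1 + (|Real.log ν| + Real.log L) ^ 3) := by gcongr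
    _ = (ε ^ 2)⁻¹ / 2 * (2 * C * (1 + (|Real.log ν| + Real.log L) ^ 3)) := by ring
    _ ≤ (ε ^ 2)⁻¹ / 2 * (ν / 2 * L ^ (1 / 16 : ℝ)) := by
        gcongr ?_ * ?_
        exact (le_abs_self _).trans hL
    _ = ν / 4 * ((ε ^ 2)⁻¹ * L ^ (1 / 16 : ℝ)) := by ring
    _ ≤ ν / 4 * (2 * densityScale L) := by gcongr
    _ < ν * densityScale L := by
        have : (0 : ℝ) < densityScale L := by exact_mod_cast hscale
        nlinarith

lemma eventually_mul_exp_neg_densityScale_le {K κ : ℝ} (hK : 0 ≤ K) (hκ : 0 < κ) :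
    ∀ᶠ L : ℕ in atTop, ∀ ε, (L : ℝ) ^ (-(1 / 32) : ℝ) ≤ ε →
      K * L ^ 2 * Real.exp (-(κ * (ε ^ 2 * densityScale L))) ≤
        Real.exp (-(L : ℝ) ^ (1 / 32 : ℝ)) := by
  filter_upwards [eventually_ge_atTop 1, eventually_mul_pow_mul_exp_neg_rpow_le K 2 (κ := κ / 2)
    (p := 1 / 16) (q := 1 / 32) (by positivity) (by norm_num) (by norm_num)] with L hL herror ε hε
  refine le_trans ?_ herror
  gcongr K * L ^ 2 * Real.exp (-?_)
  linarith [mul_le_mul_of_nonneg_left (rpow_le_sq_mul_densityScale hL hε) hκ.le]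

lemma eventually_coveringTime_mul_blockWindow_mul_exp_le {ν C κ : ℝ} (hν : 0 ≤ ν) (hC : 0 ≤ C)
    (hκ : 0 < κ) : ∀ᶠ L : ℕ in atTop, ∀ ε, (L : ℝ) ^ (-(1 / 32) : ℝ) ≤ ε →
      C * coveringTime L * blockWindow ν L * Real.exp (-(κ * ε ^ 2 * densityScale L)) ≤
        Real.exp (-(L : ℝ) ^ (1 / 32 : ℝ)) := by
  filter_upwards [eventually_mul_exp_neg_densityScale_le (K := C * (6 * ν + 3)) (by positivity) hκ,
    eventually_ge_atTop 1] with L herror hL ε hε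
  refine le_trans ?_ (herror ε hε)
  rw [mul_assoc κ]
  gcongr ?_ * Real.exp _
  calc C * coveringTime L * blockWindow ν L ≤ C * L * ((6 * ν + 3) * L) := by
        gcongr
        · exact coveringTime_le L
        · exact blockWindow_le hν hL
    _ = C * (6 * ν + 3) * L ^ 2 := by ring

/-! ### Comparison of a block with a fresh block of another density -/

namespace Environment

variable {a b : ℝ} {E : Environment a b}

lemma Covering.eventually_exists_isCoupling {ν : ℝ} (hν : 0 < ν) (hcover : E.Covering ν) :
    ∀ᶠ L : ℕ in atTop, ∀ ρ ∈ Set.Ioo a b, ∀ ε ∈ Set.Ico ((L : ℝ) ^ (-(1 / 32) : ℝ)) 1,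
      ρ + ε ∈ Set.Ioo a b → ∀ σ τ,
      NearDensity ρ ε (densityScale L) (blockWindow ν L) σ →
      NearDensity (ρ + ε) ε (densityScale L) (blockWindow ν L) τ →
      ∃ Q : Measure (EnvPath × EnvPath), IsCoupling Q (E.P τ) (E.P σ) ∧
        Q {ω | DominatesOn ⌈(2 * ν + 1) * L⌉₊ (ω.1 (coveringTime L)) (ω.2 (coveringTime L))}ᶜ ≤
          ENNReal.ofReal (Real.exp (-(L : ℝ) ^ (1 / 32 : ℝ))) := by
  obtain ⟨C, C', hC, hC', hcov⟩ := hcover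
  have tendsto_coveringTime : Tendsto (fun L => ν ^ 8 * (coveringTime L : ℝ)) atTop atTop :=
    (tendsto_natCast_atTop_atTop.comp ((tendsto_pow_atTop (by norm_num)).comp
      tendsto_densityScale)).const_mul_atTop (by positivity)
  filter_upwards [eventually_mul_inv_sq_mul_log_lt hν hC.le,
    tendsto_coveringTime.eventually_gt_atTop 1, tendsto_densityScale.eventually_ge_atTop 2,
    eventually_coveringTime_mul_blockWindow_mul_exp_le (κ := (C' * (1 + ν⁻¹))⁻¹) hν.le hC'.le
      (by positivity), eventually_ge_atTop 1]
    with L hlog hνt hscale herror hL ρ hρ ε hε hρε σ τ hσ hτ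
  have hε0 : 0 < ε := lt_of_lt_of_le (by positivity) hε.1
  have radius_le := ceil_le_blockWindow_sub hν.le hL
  obtain ⟨Q, hQ, hle⟩ := hcov ρ hρ ε ⟨hε0, hε.2⟩ hρε (blockWindow ν L) (coveringTime L)
    (Nat.ceil_pos.mpr (by positivity)) (Nat.one_le_pow _ _ (by omega))
    (by linarith [show (0 : ℝ) < ⌈(2 * ν + 1) * L⌉₊ by positivity]) hνt
    (by rw [coveringTime_rpow]; exact hlog ε hε.1) τ σ
    (by
      intro y m hlm hml hsub
      rw [coveringTime_rpow, Nat.floor_natCast] at hlm hml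
      have hy : |y| ≤ blockWindow ν L :=
        abs_le.mpr (Finset.mem_Icc.mp (hsub (Finset.mem_Ico.mpr (by omega))))
      constructor
      · linarith [(abs_le.mp (hτ y m hy hlm hml)).1]
      · linarith [(abs_le.mp (hσ y m hy hlm hml)).2])
  rw [coveringTime_rpow] at hle
  refine ⟨Q, hQ, (measure_mono (Set.compl_subset_compl.mpr ?_)).trans
    ((hQ.measure_compl_le (measurableSet_dominatesOn _
      ((measurable_pi_apply _).comp measurable_fst)
      ((measurable_pi_apply _).comp measurable_snd)) hle).trans
    (ENNReal.ofReal_le_ofReal (herror ε hε.1)))⟩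
  exact fun ω (hω : DominatesOn _ _ _) x hx => hω x (hx.trans radius_le)

variable (E)

lemma exists_measure_lt_abs_mass_sub_le : ∃ c : ℝ, 0 < c ∧
    ∀ ρ ∈ Set.Ioo a b, ∀ ε ∈ Set.Ioo (0 : ℝ) 1, ∀ (y : ℤ) (m : ℕ), 1 ≤ m →
      (E.μ ρ : Measure Config) {σ | ε * m < |(σ.mass y m : ℝ) - ρ * m|} ≤
        ENNReal.ofReal (2 * Real.exp (-(c * ε ^ 2 * m))) := by
  obtain ⟨c, hc, hdensity⟩ := E.density
  refine ⟨c, hc, fun ρ hρ ε hε y m hm => ?_⟩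
  have hmeas : MeasurableSet {σ : Config | ε * m ≤ |(σ.mass 0 m : ℝ) - ρ * m|} :=
    measurableSet_le measurable_const (measurable_abs_mass_sub 0 m _)
  calc (E.μ ρ : Measure Config) {σ | ε * m < |(σ.mass y m : ℝ) - ρ * m|}
      ≤ (E.μ ρ : Measure Config) {σ | ε * m ≤ |(σ.mass y m : ℝ) - ρ * m|} :=
        measure_mono (Set.ofPred_subset_ofPred.mpr fun σ hσ => hσ.le)
    _ = (E.μ ρ : Measure Config) {σ | ε * m ≤ |(σ.mass 0 m : ℝ) - ρ * m|} := by
        nth_rewrite 2 [← E.translation_invariant ρ hρ y]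
        rw [Measure.map_apply (measurable_translate y) hmeas]
        simp only [Set.preimage_ofPred_eq, Config.mass_translate, add_zero]
    _ = E.law ρ {η | ε * m ≤ |((η 0).mass 0 m : ℝ) - ρ * m|} := (E.law_apply_zero ρ hmeas).symm
    _ ≤ ENNReal.ofReal (2 * Real.exp (-(c * ε ^ 2 * m))) := by
        rw [← ofReal_measureReal]
        exact ENNReal.ofReal_le_ofReal (hdensity ρ hρ ε hε m hm)

lemma exists_measure_compl_nearDensity_le : ∃ c : ℝ, 0 < c ∧
    ∀ ρ ∈ Set.Ioo a b, ∀ ε ∈ Set.Ioo (0 : ℝ) 1, ∀ l r : ℕ, 2 ≤ l →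
      (E.μ ρ : Measure Config) {σ | NearDensity ρ ε l r σ}ᶜ ≤
        ENNReal.ofReal ((2 * r + 1) * (l + 1) * (2 * Real.exp (-(c * ε ^ 2 * l)))) := by
  obtain ⟨c, hc, hmass⟩ := E.exists_measure_lt_abs_mass_sub_le
  refine ⟨c / 48, by positivity, fun ρ hρ ε hε l r hl => ?_⟩
  set intervals := Finset.Icc (-(r : ℤ)) r ×ˢ Finset.Icc (l / 2) l
  have card_le : (intervals.card : ℝ) ≤ (2 * r + 1) * (l + 1) := by
    have : intervals.card ≤ (2 * r + 1) * (l + 1) := by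
      rw [Finset.card_product, Int.card_Icc, Nat.card_Icc]
      exact Nat.mul_le_mul (by omega) (by omega)
    exact_mod_cast this
  have compl_subset : {σ | NearDensity ρ ε l r σ}ᶜ ⊆ ⋃ I ∈ intervals,
      {σ : Config | ε / 4 * I.2 < |(σ.mass I.1 I.2 : ℝ) - ρ * I.2|} := by
    intro σ hσ
    simp only [NearDensity, Set.mem_compl_iff, Set.mem_ofPred_eq, not_forall, not_le] at hσ
    obtain ⟨y, m, hy, hlm, hml, hlt⟩ := hσ
    exact Set.mem_biUnion (x := (y, m)) (Finset.mem_product.mpr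
      ⟨Finset.mem_Icc.mpr (abs_le.mp hy), Finset.mem_Icc.mpr ⟨hlm, hml⟩⟩) hlt
  have interval_le : ∀ I ∈ intervals, (E.μ ρ : Measure Config)
      {σ : Config | ε / 4 * I.2 < |(σ.mass I.1 I.2 : ℝ) - ρ * I.2|} ≤
        ENNReal.ofReal (2 * Real.exp (-(c / 48 * ε ^ 2 * l))) := by
    intro I hI
    have half_le : l / 2 ≤ I.2 := (Finset.mem_Icc.mp (Finset.mem_product.mp hI).2).1
    have third_le : (l : ℝ) ≤ 3 * I.2 := by exact_mod_cast (by omega : l ≤ 3 * I.2)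
    refine (hmass ρ hρ (ε / 4) ⟨by linarith [hε.1], by linarith [hε.1, hε.2]⟩ I.1 I.2
      (by omega)).trans (ENNReal.ofReal_le_ofReal ?_)
    gcongr 2 * Real.exp (-?_)
    calc c / 48 * ε ^ 2 * l ≤ c / 48 * ε ^ 2 * (3 * I.2) := by gcongr
      _ = c * (ε / 4) ^ 2 * I.2 := by ring
  calc (E.μ ρ : Measure Config) {σ | NearDensity ρ ε l r σ}ᶜ
      ≤ ∑ _I ∈ intervals, ENNReal.ofReal (2 * Real.exp (-(c / 48 * ε ^ 2 * l))) :=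
        (measure_mono compl_subset).trans ((measure_biUnion_finset_le _ _).trans
          (Finset.sum_le_sum interval_le))
    _ = ENNReal.ofReal (intervals.card * (2 * Real.exp (-(c / 48 * ε ^ 2 * l)))) := by
        rw [Finset.sum_const, ← ENNReal.ofReal_nsmul, nsmul_eq_mul]
    _ ≤ _ := by gcongr

lemma eventually_measure_compl_nearDensity_le {K : ℝ} (hK : 0 ≤ K) : ∀ᶠ L : ℕ in atTop,
    ∀ ρ ∈ Set.Ioo a b, ∀ ε ∈ Set.Ico ((L : ℝ) ^ (-(1 / 32) : ℝ)) 1,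
      ∀ m r : ℕ, 1 ≤ m → r ≤ K * (m * L) →
      (E.μ ρ : Measure Config) {σ | NearDensity ρ ε (densityScale L) r σ}ᶜ ≤
        ENNReal.ofReal (m * Real.exp (-(L : ℝ) ^ (1 / 32 : ℝ))) := by
  obtain ⟨c, hc, hdensity⟩ := E.exists_measure_compl_nearDensity_le
  filter_upwards [tendsto_densityScale.eventually_ge_atTop 2, eventually_ge_atTop 1,
    eventually_mul_exp_neg_densityScale_le (K := 4 * (2 * K + 1)) (by positivity) hc]
    with L hscale hL herror ρ hρ ε hε m r hm hr
  have hL' : (1 : ℝ) ≤ L := Nat.one_le_cast.mpr hL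
  have hm' : (1 : ℝ) ≤ m := Nat.one_le_cast.mpr hm
  have hε0 : 0 < ε := lt_of_lt_of_le (by positivity) hε.1
  refine (hdensity ρ hρ ε ⟨hε0, hε.2⟩ _ r hscale).trans (ENNReal.ofReal_le_ofReal ?_)
  rw [mul_assoc c]
  calc (2 * r + 1) * (densityScale L + 1) * (2 * Real.exp (-(c * (ε ^ 2 * densityScale L))))
      ≤ (2 * (K * (m * L)) + m * L) * (L + L) *
          (2 * Real.exp (-(c * (ε ^ 2 * densityScale L)))) := by
        gcongr
        · nlinarith
        · exact densityScale_le L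
    _ = m * (4 * (2 * K + 1) * L ^ 2 * Real.exp (-(c * (ε ^ 2 * densityScale L)))) := by ring
    _ ≤ m * Real.exp (-(L : ℝ) ^ (1 / 32 : ℝ)) := by
        gcongr
        exact herror ε hε.1

lemma le_law_add_measure (ρ : ℝ) {q e : ℝ≥0∞} (hq : q ≤ 1) {A : Set EnvPath} (hA : MeasurableSet A)
    {B : Set Config} (h : ∀ τ ∉ B, q ≤ E.P τ A + e) :
    q ≤ E.law ρ A + e + (E.μ ρ : Measure Config) B := by
  rw [E.law_apply ρ hA]
  simpa using lintegral_le_lintegral_add_measure (Q := (E.μ ρ : Measure Config)) (f := fun _ => q)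
    (E.P.measurable_coe hA) (fun _ => hq) h

variable {E}

section

variable {ν : ℝ} (hν : 0 < ν) (hdrift : E.NoDriftIn ν) (hcover : E.Covering ν) {pE pO : ℝ}
  (hp : pE ≤ pO)

include hν hdrift hcover hp

lemma eventually_measure_walkFrom_le_of_nearDensity : ∀ᶠ L : ℕ in atTop, ∀ ρ ∈ Set.Ioo a b,
    ∀ ε ∈ Set.Ico ((L : ℝ) ^ (-(1 / 32) : ℝ)) 1, ρ + ε ∈ Set.Ioo a b → ∀ σ τ,
      NearDensity ρ ε (densityScale L) (blockWindow ν L) σ →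
      NearDensity (ρ + ε) ε (densityScale L) (blockWindow ν L) τ →
      ∀ x : ℤ, |x + coveringTime L| ≤ coveringTime L → ∀ (u : ℕ → unitInterval) (c : ℤ),
      E.P σ {η | c ≤ walkFrom pE pO x η u L} ≤
        E.P τ {η | c ≤ walkFrom pE pO (x + 2 * coveringTime L) η u L} +
          ENNReal.ofReal (2 * Real.exp (-(L : ℝ) ^ (1 / 32 : ℝ))) := by
  filter_upwards [hcover.eventually_exists_isCoupling hν, eventually_ge_atTop 2,
    eventually_mul_pow_mul_exp_neg_rpow_le 20 0 (κ := ν / 8) (p := 1) (q := 1 / 32)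
      (by positivity) (by norm_num) (by norm_num)]
    with L hcoupling hL drift_error_le ρ hρ ε hε hρε σ τ hσ hτ x hx u c
  obtain ⟨Q, hQ, hQ_le⟩ := hcoupling ρ hρ ε hε hρε σ τ hσ hτ
  obtain ⟨n, hn⟩ := Nat.exists_eq_add_of_le
    (show coveringTime L ≤ L by linarith [two_mul_coveringTime_le hL])
  have hn' : (L : ℝ) = coveringTime L + n := by exact_mod_cast hn
  have half_le : (L : ℝ) / 2 ≤ n := by
    have : (2 * coveringTime L : ℝ) ≤ L := by exact_mod_cast two_mul_coveringTime_le hL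
    linarith
  have hx' : |((x + coveringTime L : ℤ) : ℝ)| ≤ coveringTime L := by exact_mod_cast hx
  have walk_stays : |((x + coveringTime L : ℤ) : ℝ)| + n + 2 * ν * n ≤ ⌈(2 * ν + 1) * L⌉₊ := by
    have : 2 * ν * n ≤ 2 * ν * L := by
      gcongr
      linarith
    linarith [Nat.le_ceil ((2 * ν + 1) * L)]
  have hwalk := measure_walkFrom_le_of_covered hdrift hp hQ hQ_le walk_stays u c
  rw [← hn] at hwalk
  refine hwalk.trans ?_
  rw [← ENNReal.ofReal_add (by positivity) (by positivity), two_mul (Real.exp _)]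
  gcongr
  refine le_trans ?_ drift_error_le
  rw [pow_zero, mul_one, Real.rpow_one]
  gcongr 20 * Real.exp (-?_)
  linarith [mul_le_mul_of_nonneg_left half_le hν.le]

/-- For `s = -1` the coupling is applied to the complementary events, with the fresh environment,
which has the lower density, shifted against the direction of the walk. -/
lemma eventually_exists_measure_mul_walkFrom_le : ∀ᶠ L : ℕ in atTop, ∀ ρ ∈ Set.Ioo a b,
    ∀ ε ∈ Set.Ico ((L : ℝ) ^ (-(1 / 32) : ℝ)) 1, ∀ s : ℤ, IsUnit s → ρ + s * ε ∈ Set.Ioo a b →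
      ∃ x : ℤ, s * x = 2 * coveringTime L ∧
      ∀ σ τ, NearDensity ρ ε (densityScale L) (blockWindow ν L) σ →
      NearDensity (ρ + s * ε) ε (densityScale L) (blockWindow ν L) τ →
      ∀ (u : ℕ → unitInterval) (c : ℤ),
      E.P σ {η | c ≤ s * walkFrom pE pO 0 η u L} ≤
        E.P τ {η | c ≤ s * walkFrom pE pO x η u L} +
          ENNReal.ofReal (2 * Real.exp (-(L : ℝ) ^ (1 / 32 : ℝ))) := by
  filter_upwards [eventually_measure_walkFrom_le_of_nearDensity hν hdrift hcover hp]
    with L hcompare ρ hρ ε hε s hs hρε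
  rcases Int.isUnit_iff.mp hs with rfl | rfl
  · simp only [Int.cast_one, one_mul] at hρε ⊢
    refine ⟨2 * coveringTime L, rfl, fun σ τ hσ hτ u c => ?_⟩
    simpa using hcompare ρ hρ ε hε hρε σ τ hσ hτ 0 (by simp) u c
  · simp only [Int.reduceNeg, Int.cast_neg, Int.cast_one, neg_mul, one_mul] at hρε ⊢
    refine ⟨-(2 * coveringTime L), neg_neg _, fun σ τ hσ hτ u c => ?_⟩
    have hle := hcompare (ρ + -ε) hρε ε hε (by simpa using hρ) τ σ hτ (by simpa using hσ)
      (-(2 * coveringTime L)) (by simp [two_mul]) u (1 - c)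
    rw [neg_add_cancel] at hle
    have hmeas (x : ℤ) := measurableSet_walkFrom pE pO x u L fun z => 1 - c ≤ z
    have compl_eq (x : ℤ) : {η | 1 - c ≤ walkFrom pE pO x η u L}ᶜ =
        {η | c ≤ -walkFrom pE pO x η u L} := by
      ext η
      simp only [Set.mem_compl_iff, Set.mem_ofPred_eq]
      omega
    simpa only [compl_eq] using measure_compl_le_measure_compl_add (hmeas _) (hmeas _) hle

lemma eventually_measure_walkFrom_le_law : ∀ᶠ L : ℕ in atTop, ∀ ρ ∈ Set.Ioo a b,
    ∀ ε ∈ Set.Ico ((L : ℝ) ^ (-(1 / 32) : ℝ)) 1, ∀ s : ℤ, IsUnit s → ρ + s * ε ∈ Set.Ioo a b →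
      ∀ σ, NearDensity ρ ε (densityScale L) (blockWindow ν L) σ →
      ∀ (u : ℕ → unitInterval) (c : ℤ),
      E.P σ {η | c ≤ s * walkFrom pE pO 0 η u L} ≤
        E.law (ρ + s * ε) {η | c ≤ s * walkFrom pE pO 0 η u L + 2 * coveringTime L} +
          ENNReal.ofReal (3 * Real.exp (-(L : ℝ) ^ (1 / 32 : ℝ))) := by
  filter_upwards [eventually_exists_measure_mul_walkFrom_le hν hdrift hcover hp,
    E.eventually_measure_compl_nearDensity_le (K := 6 * ν + 3) (by positivity),
    eventually_ge_atTop 1] with L hcompare hdensity hL ρ hρ ε hε s hs hρε σ hσ u c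
  obtain ⟨x, hx, hle⟩ := hcompare ρ hρ ε hε s hs hρε
  set δ := Real.exp (-(L : ℝ) ^ (1 / 32 : ℝ))
  have fresh_density := hdensity (ρ + s * ε) hρε ε hε 1 (blockWindow ν L) le_rfl
    (by simpa using blockWindow_le hν.le hL)
  rw [Nat.cast_one, one_mul] at fresh_density
  have error_add : ENNReal.ofReal (3 * δ) = ENNReal.ofReal (2 * δ) + ENNReal.ofReal δ := by
    rw [← ENNReal.ofReal_add (by positivity) (by positivity)]
    ring_nf
  have law_eq := E.law_walkFrom_eq pE pO x u L (fun z => c ≤ s * z) hρε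
  simp only [mul_add, hx, add_comm (2 * (coveringTime L : ℤ))] at law_eq
  rw [error_add, ← add_assoc, ← law_eq]
  refine (E.le_law_add_measure (ρ + s * ε) prob_le_one
    (measurableSet_walkFrom pE pO x u L fun z => c ≤ s * z)
    (B := {τ | NearDensity (ρ + s * ε) ε (densityScale L) (blockWindow ν L) τ}ᶜ)
    fun τ hτ => hle σ τ hσ (not_not.mp hτ) u c).trans ?_
  gcongr

end

end Environment

/-! ### Comparison of successive blocks with independent blocks -/

/-- The law of the i.i.d. uniform variables driving the walk. -/
noncomputable abbrev uniformLaw : Measure (ℕ → unitInterval) :=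
  Measure.infinitePi fun _ : ℕ => (volume : Measure unitInterval)

/-- The space on which the annealed law lives: environments together with driving variables. -/
abbrev WalkSpace : Type := EnvPath × (ℕ → unitInterval)

instance (P : Measure EnvPath) [IsProbabilityMeasure P] : IsProbabilityMeasure (annealed P) := by
  unfold annealed; infer_instance

lemma lintegral_uniformLaw_concatAt (s : ℕ) {f : (ℕ → unitInterval) → ℝ≥0∞} (hf : Measurable f) :
    ∫⁻ u, f u ∂uniformLaw = ∫⁻ u, ∫⁻ v, f (concatAt s u v) ∂uniformLaw ∂uniformLaw := by
  nth_rewrite 1 [uniformLaw, ← map_concatAt (volume : Measure unitInterval) s]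
  rw [lintegral_map hf (measurable_concatAt s)]
  exact lintegral_prod _ (hf.comp (measurable_concatAt s)).aemeasurable

section

variable (P P' : Measure EnvPath) [IsProbabilityMeasure P] [IsProbabilityMeasure P']

lemma lintegral_annealed {f : WalkSpace → ℝ≥0∞} (hf : Measurable f) :
    ∫⁻ ω, f ω ∂(annealed P) = ∫⁻ u, ∫⁻ η, f (η, u) ∂P ∂uniformLaw :=
  lintegral_prod_symm _ hf.aemeasurable

lemma annealed_apply {A : Set WalkSpace} (hA : MeasurableSet A) :
    annealed P A = ∫⁻ u, P {η | (η, u) ∈ A} ∂uniformLaw :=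
  Measure.prod_apply_symm hA

/-- The driving variables used before and after time `K` are independent. -/
lemma lintegral_prod_walkFrom (pE pO : ℝ) (K L : ℕ) (p : ℤ → ℤ → Prop) :
    ∫⁻ u, (P.prod P') {ω | p (walkFrom pE pO 0 ω.1 u K)
        (walkFrom pE pO 0 ω.2 (fun k => u (K + k)) L)} ∂uniformLaw =
      ((annealed P).prod (annealed P'))
        {ω | p (walkFrom pE pO 0 ω.1.1 ω.1.2 K) (walkFrom pE pO 0 ω.2.1 ω.2.2 L)} := by
  have hmeas {α : Type} [MeasurableSpace α] {η ζ : α → EnvPath} {u v : α → ℕ → unitInterval}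
      (hη : Measurable η) (hζ : Measurable ζ) (hu : Measurable u) (hv : Measurable v) :
      MeasurableSet {x | p (walkFrom pE pO 0 (η x) (u x) K) (walkFrom pE pO 0 (ζ x) (v x) L)} :=
    ((measurable_walkFrom pE pO K measurable_const hη hu).prodMk
      (measurable_walkFrom pE pO L measurable_const hζ hv))
      (.of_discrete (s := {z : ℤ × ℤ | p z.1 z.2}))
  have hmeas_restart : Measurable fun u : ℕ → unitInterval => (P.prod P') {ω | p
      (walkFrom pE pO 0 ω.1 u K) (walkFrom pE pO 0 ω.2 (fun k => u (K + k)) L)} :=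
    measurable_measure_prodMk_left (hmeas (α := (ℕ → unitInterval) × EnvPath × EnvPath)
      (η := fun x => x.2.1) (ζ := fun x => x.2.2) (v := fun x k => x.1 (K + k)) (by fun_prop)
      (by fun_prop) measurable_fst (by fun_prop))
  have walkFrom_concatAt (η : EnvPath) (u v : ℕ → unitInterval) :
      walkFrom pE pO 0 η (concatAt K u v) K = walkFrom pE pO 0 η u K :=
    walkFrom_congr pE pO 0 (fun _ _ => rfl) fun k hk => concatAt_of_lt hk u v
  rw [lintegral_uniformLaw_concatAt K hmeas_restart,
    Measure.prod_apply (hmeas (by fun_prop) (by fun_prop) (by fun_prop) (by fun_prop)),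
    lintegral_annealed P (measurable_measure_prodMk_left
      (hmeas (by fun_prop) (by fun_prop) (by fun_prop) (by fun_prop)))]
  refine lintegral_congr fun u => ?_
  simp only [walkFrom_concatAt, concatAt_add]
  calc ∫⁻ v, (P.prod P') {ω | p (walkFrom pE pO 0 ω.1 u K) (walkFrom pE pO 0 ω.2 v L)} ∂uniformLaw
      = ∫⁻ v, ∫⁻ η, P' {ζ | p (walkFrom pE pO 0 η u K) (walkFrom pE pO 0 ζ v L)} ∂P ∂uniformLaw :=
        lintegral_congr fun v => Measure.prod_apply
          (hmeas measurable_fst measurable_snd measurable_const measurable_const)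
    _ = ∫⁻ η, ∫⁻ v, P' {ζ | p (walkFrom pE pO 0 η u K) (walkFrom pE pO 0 ζ v L)} ∂uniformLaw ∂P :=
        lintegral_lintegral_swap (measurable_measure_prodMk_left (hmeas
          (measurable_snd.comp measurable_fst) measurable_snd measurable_const
          (measurable_fst.comp measurable_fst))).aemeasurable
    _ = ∫⁻ η, annealed P' {ω | p (walkFrom pE pO 0 η u K) (walkFrom pE pO 0 ω.1 ω.2 L)} ∂P :=
        lintegral_congr fun η => (annealed_apply P'
          (hmeas measurable_const measurable_fst measurable_const measurable_snd)).symm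

end

namespace Environment

variable {a b : ℝ} (E : Environment a b) {pE pO ρ ρ' ε : ℝ} {s d : ℤ} {l L R r : ℕ} {e : ℝ≥0∞}
  (hρ : ρ ∈ Set.Ioo a b)
  (hblock : ∀ σ, NearDensity ρ ε l R σ → ∀ u c, E.P σ {η | c ≤ s * walkFrom pE pO 0 η u L} ≤
    E.law ρ' {η | c ≤ s * walkFrom pE pO 0 η u L + d} + e)

include hρ hblock

lemma law_walkFrom_add_le {K : ℕ} (hr : R + K ≤ r) (u : ℕ → unitInterval) (c : ℤ) :
    E.law ρ {η | c ≤ s * walkFrom pE pO 0 η u (K + L)} ≤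
      ((E.law ρ).prod (E.law ρ')) {ω | c ≤ s * walkFrom pE pO 0 ω.1 u K +
        (s * walkFrom pE pO 0 ω.2 (fun k => u (K + k)) L + d)} +
      (e + (E.μ ρ : Measure Config) {σ | NearDensity ρ ε l r σ}ᶜ) := by
  set B : Set Config := {σ | NearDensity ρ ε l r σ}ᶜ
  have hB : MeasurableSet B := (measurableSet_nearDensity ρ ε l r).compl
  have hmeas : MeasurableSet {ω : EnvPath × EnvPath | c ≤ s * walkFrom pE pO 0 ω.1 u K +
      (s * walkFrom pE pO 0 ω.2 (fun k => u (K + k)) L + d)} :=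
    measurableSet_le measurable_const (by fun_prop)
  rw [E.law_walkFrom_add pE pO 0 u K L (fun z => c ≤ s * z), ← E.law_apply_time hρ K hB,
    ← add_assoc, Measure.prod_apply hmeas]
  refine lintegral_le_lintegral_add_measure (measurable_measure_prodMk_left hmeas)
    (fun _ => prob_le_one) fun η hη => ?_
  set x := walkFrom pE pO 0 η u K
  have hx : |x| ≤ K := by simpa using abs_walkFrom_sub_le pE pO 0 η u K
  have hnear : NearDensity ρ ε l R (Config.translate x (η K)) :=
    (not_not.mp hη : NearDensity ρ ε l r (η K)).translate x (by omega)
  rw [E.measure_walkFrom_eq_translate pE pO x _ L (fun z => c ≤ s * z)]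
  convert hblock _ hnear (fun k => u (K + k)) (c - s * x) using 4 with ζ ζ
  · rw [mul_add, sub_le_iff_le_add']
  · simp only [Set.preimage_ofPred_eq, sub_le_iff_le_add']
    rfl

lemma annealed_walkFrom_add_le {K : ℕ} (hr : R + K ≤ r) (c : ℤ) :
    annealed (E.law ρ) {ω | c ≤ s * walkFrom pE pO 0 ω.1 ω.2 (K + L)} ≤
      ((annealed (E.law ρ)).prod (annealed (E.law ρ'))) {ω |
        c ≤ s * walkFrom pE pO 0 ω.1.1 ω.1.2 K + (s * walkFrom pE pO 0 ω.2.1 ω.2.2 L + d)} +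
      (e + (E.μ ρ : Measure Config) {σ | NearDensity ρ ε l r σ}ᶜ) := by
  rw [annealed_apply _ (measurableSet_le measurable_const (by fun_prop)),
    ← lintegral_prod_walkFrom _ _ pE pO K L fun y z => c ≤ s * y + (s * z + d)]
  refine (lintegral_mono fun u => E.law_walkFrom_add_le hρ hblock hr u c).trans ?_
  rw [lintegral_add_right _ measurable_const, lintegral_const, measure_univ, mul_one]

/-- Exponential Markov inequality: up to the coupling errors, the `m` blocks are independent. -/
lemma annealed_walkFrom_mul_le {θ : ℝ} (hθ : 0 ≤ θ) (m : ℕ) (hr : R + m * L ≤ r) (c : ℤ) :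
    annealed (E.law ρ) {ω | c ≤ s * walkFrom pE pO 0 ω.1 ω.2 (m * L)} ≤
      ENNReal.ofReal (Real.exp (-(θ * c))) *
        (∫⁻ ω, ENNReal.ofReal (Real.exp (θ * (s * walkFrom pE pO 0 ω.1 ω.2 L + d)))
          ∂(annealed (E.law ρ'))) ^ m +
      m * (e + (E.μ ρ : Measure Config) {σ | NearDensity ρ ε l r σ}ᶜ) := by
  set blockMGF := ∫⁻ ω, ENNReal.ofReal (Real.exp (θ * (s * walkFrom pE pO 0 ω.1 ω.2 L + d)))
    ∂(annealed (E.law ρ'))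
  set e' := e + (E.μ ρ : Measure Config) {σ | NearDensity ρ ε l r σ}ᶜ
  induction m generalizing c with
  | zero =>
    rcases le_or_gt c 0 with hc | hc
    · have hc' : (c : ℝ) ≤ 0 := Int.cast_nonpos.mpr hc
      simpa [hc] using mul_nonpos_of_nonneg_of_nonpos hθ hc'
    · simp [hc.not_ge]
  | succ m ih =>
    have hr' : R + m * L ≤ r := by nlinarith
    have hmeas : Measurable fun ω : WalkSpace =>
        ENNReal.ofReal (Real.exp (θ * (s * walkFrom pE pO 0 ω.1 ω.2 L + d))) := by fun_prop
    have hmeas_prod : MeasurableSet {ω : WalkSpace × WalkSpace |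
        c ≤ s * walkFrom pE pO 0 ω.1.1 ω.1.2 (m * L) +
          (s * walkFrom pE pO 0 ω.2.1 ω.2.2 L + d)} :=
      measurableSet_le measurable_const (by fun_prop)
    rw [Nat.succ_mul]
    refine (E.annealed_walkFrom_add_le hρ hblock hr' c).trans ?_
    rw [Measure.prod_apply_symm hmeas_prod]
    calc _ ≤ ∫⁻ ω, (ENNReal.ofReal (Real.exp (-(θ * c))) * blockMGF ^ m *
          ENNReal.ofReal (Real.exp (θ * (s * walkFrom pE pO 0 ω.1 ω.2 L + d))) + m * e')
            ∂(annealed (E.law ρ')) + e' := by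
          gcongr with ω
          have hstep := ih hr' (c - (s * walkFrom pE pO 0 ω.1 ω.2 L + d))
          simp only [sub_le_iff_le_add] at hstep
          refine hstep.trans (le_of_eq ?_)
          rw [mul_right_comm, ← ENNReal.ofReal_mul (by positivity), ← Real.exp_add]
          congr 4
          push_cast
          ring
      _ = ENNReal.ofReal (Real.exp (-(θ * c))) * blockMGF ^ (m + 1) + (m + 1 : ℕ) * e' := by
          rw [lintegral_add_right _ measurable_const, lintegral_const_mul _ hmeas, lintegral_const,
            measure_univ, mul_one]
          push_cast
          ring

end Environment

/-! ### Deviations of the walk after many blocks -/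

lemma abs_walkFrom_zero_le (pE pO : ℝ) (η : EnvPath) (u : ℕ → unitInterval) (n : ℕ) :
    |(walkFrom pE pO 0 η u n : ℝ)| ≤ n := by
  exact_mod_cast (sub_zero (walkFrom pE pO 0 η u n)) ▸ abs_walkFrom_sub_le pE pO 0 η u n

section

variable (P : Measure EnvPath) [IsProbabilityMeasure P] (pE pO : ℝ)

lemma integrable_walkFrom (n : ℕ) :
    Integrable (fun ω : WalkSpace => (walkFrom pE pO 0 ω.1 ω.2 n : ℝ)) (annealed P) :=
  .of_bound (by fun_prop) n (ae_of_all _ fun ω => abs_walkFrom_zero_le pE pO ω.1 ω.2 n)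

lemma lintegral_exp_walkFrom_le {s : ℤ} (hs : IsUnit s) (n : ℕ) (θ d : ℝ) :
    ∫⁻ ω, ENNReal.ofReal (Real.exp (θ * (s * walkFrom pE pO 0 ω.1 ω.2 n + d))) ∂(annealed P) ≤
      ENNReal.ofReal (Real.exp (θ * (s * (∫ ω, (walkFrom pE pO 0 ω.1 ω.2 n : ℝ) ∂(annealed P)) + d)
        + n ^ 2 * θ ^ 2 / 2)) := by
  set X : WalkSpace → ℝ := fun ω => s * walkFrom pE pO 0 ω.1 ω.2 n with hX
  have X_mem : ∀ᵐ ω ∂(annealed P), X ω ∈ Set.Icc (-(n : ℝ)) n := by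
    refine ae_of_all _ fun ω => abs_le.mp ?_
    have abs_s : |(s : ℝ)| = 1 := by exact_mod_cast Int.isUnit_iff_abs_eq.mp hs
    simpa [hX, abs_mul, abs_s] using abs_walkFrom_zero_le pE pO ω.1 ω.2 n
  have mean_X : (annealed P)[X] = s * ∫ ω, (walkFrom pE pO 0 ω.1 ω.2 n : ℝ) ∂(annealed P) :=
    integral_const_mul _ _
  have subgaussian := hasSubgaussianMGF_of_mem_Icc (by fun_prop : Measurable X).aemeasurable X_mem
  have variance_eq : (((‖(n : ℝ) - -n‖₊ / 2) ^ 2 : NNReal) : ℝ) = (n : ℝ) ^ 2 := by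
    push_cast
    rw [sub_neg_eq_add, Real.norm_of_nonneg (by positivity)]
    ring
  have exp_eq (ω : WalkSpace) : Real.exp (θ * (s * walkFrom pE pO 0 ω.1 ω.2 n + d)) =
      Real.exp (θ * ((annealed P)[X] + d)) * Real.exp (θ * (X ω - (annealed P)[X])) := by
    rw [← Real.exp_add, hX]
    ring_nf
  simp only [exp_eq]
  rw [← ofReal_integral_eq_lintegral_ofReal ((subgaussian.integrable_exp_mul θ).const_mul _)
      (ae_of_all _ fun ω => by positivity), integral_const_mul, ← mean_X, Real.exp_add]
  have mgf_le := subgaussian.mgf_le θ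
  rw [variance_eq] at mgf_le
  gcongr
  exact mgf_le

lemma integral_annealed_map {α : Type*} [MeasurableSpace α] (P : Measure α) [IsProbabilityMeasure P]
    {g : α → EnvPath} (hg : Measurable g) {f : WalkSpace → ℝ} (hf : Measurable f) :
    ∫ ω, f ω ∂(annealed (P.map g)) = ∫ ω, f (g ω.1, ω.2) ∂(P.prod uniformLaw) := by
  have map_eq : annealed (P.map g) = (P.prod uniformLaw).map (Prod.map g id) := by
    rw [← Measure.map_prod_map P uniformLaw hg measurable_id, Measure.map_id]
    rfl
  rw [map_eq, integral_map (hg.prodMap measurable_id).aemeasurable hf.aestronglyMeasurable]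
  rfl

end

namespace Environment

variable {a b : ℝ} (E : Environment a b)

lemma integral_walkFrom_eq (pE pO ρ : ℝ) (L : ℕ) :
    ∫ ω, (walkFrom pE pO 0 ω.1 ω.2 L : ℝ) ∂(annealed (E.law ρ)) =
      L * E.finiteRangeSpeed pE pO ρ L := by
  rcases L.eq_zero_or_pos with rfl | hL
  · simp
  have hmeas : Measurable fun ω : WalkSpace => (walkFrom pE pO 0 ω.1 ω.2 L : ℝ) := by fun_prop
  have first_block (ω : (ℕ → EnvPath) × (ℕ → unitInterval)) :
      walkFrom pE pO 0 (fun t => ω.1 (t / L) (t % L)) ω.2 L = walkFrom pE pO 0 (ω.1 0) ω.2 L :=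
    walkFrom_congr pE pO 0 (fun k hk => by rw [Nat.div_eq_of_lt hk, Nat.mod_eq_of_lt hk])
      fun _ _ => rfl
  have first_law := integral_annealed_map (Measure.infinitePi fun _ : ℕ => E.law ρ)
    (measurable_pi_apply 0) hmeas
  rw [Measure.infinitePi_map_eval] at first_law
  simp only [finiteRangeSpeed, walk_eq_walkFrom, integral_div]
  rw [mul_div_cancel₀ _ (by positivity), finiteRangeLaw,
    integral_annealed_map _ (by fun_prop) hmeas]
  simp only [first_block]
  exact first_law

lemma abs_finiteRangeSpeed_le (pE pO ρ : ℝ) (L : ℕ) : |E.finiteRangeSpeed pE pO ρ L| ≤ 1 := by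
  rcases L.eq_zero_or_pos with rfl | hL
  · simp [finiteRangeSpeed]
  have hL' : (0 : ℝ) < L := Nat.cast_pos.mpr hL
  have hle := norm_integral_le_of_norm_le_const (μ := annealed (E.law ρ)) (C := L)
    (f := fun ω : WalkSpace => (walkFrom pE pO 0 ω.1 ω.2 L : ℝ))
    (ae_of_all _ fun ω => abs_walkFrom_zero_le pE pO ω.1 ω.2 L)
  rw [E.integral_walkFrom_eq, Real.norm_eq_abs, abs_mul, abs_of_pos hL', probReal_univ, mul_one]
    at hle
  exact (mul_le_iff_le_one_right hL').mp hle

lemma annealed_deviation_le {pE pO ρ ρ' ε : ℝ} {s d : ℤ} {l L R r m : ℕ} {e : ℝ≥0∞}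
    (hρ : ρ ∈ Set.Ioo a b) (hs : IsUnit s)
    (hblock : ∀ σ, NearDensity ρ ε l R σ → ∀ u c, E.P σ {η | c ≤ s * walkFrom pE pO 0 η u L} ≤
      E.law ρ' {η | c ≤ s * walkFrom pE pO 0 η u L + d} + e)
    (hr : R + m * L ≤ r) (hm : 1 ≤ m) (hL : 1 ≤ L) {y : ℝ} (hy : 0 ≤ y) :
    annealed (E.law ρ) {ω | m * (s * (L * E.finiteRangeSpeed pE pO ρ' L) + d) + y ≤
        s * walkFrom pE pO 0 ω.1 ω.2 (m * L)} ≤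
      ENNReal.ofReal (Real.exp (-(y ^ 2 / (2 * m * L ^ 2)))) +
        m * (e + (E.μ ρ : Measure Config) {σ | NearDensity ρ ε l r σ}ᶜ) := by
  set V := s * (L * E.finiteRangeSpeed pE pO ρ' L) + d
  set θ : ℝ := y / (m * L ^ 2) with hθ
  have event_eq : {ω : WalkSpace | m * V + y ≤ s * walkFrom pE pO 0 ω.1 ω.2 (m * L)} =
      {ω | ⌈m * V + y⌉ ≤ s * walkFrom pE pO 0 ω.1 ω.2 (m * L)} := by
    ext ω
    simp only [Set.mem_ofPred_eq, Int.ceil_le, Int.cast_mul]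
  have block_le := lintegral_exp_walkFrom_le (E.law ρ') pE pO hs L θ d
  rw [E.integral_walkFrom_eq] at block_le
  rw [event_eq]
  refine (E.annealed_walkFrom_mul_le hρ hblock (by positivity : 0 ≤ θ) m hr _).trans ?_
  gcongr
  calc _ ≤ ENNReal.ofReal (Real.exp (-(θ * (m * V + y)))) *
        ENNReal.ofReal (Real.exp (θ * V + L ^ 2 * θ ^ 2 / 2)) ^ m := by
        gcongr
        exact Int.le_ceil _
    _ = ENNReal.ofReal (Real.exp (-(y ^ 2 / (2 * m * L ^ 2)))) := by
        rw [← ENNReal.ofReal_pow (by positivity), ← ENNReal.ofReal_mul (by positivity),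
          ← Real.exp_nat_mul, ← Real.exp_add, hθ]
        congr 2
        field_simp
        ring

lemma mul_add_mul_le_sq_mul {m c e : ℝ} (hm : 1 ≤ m) (hc : 0 ≤ c) (h : 4 * c ≤ e) :
    m * (3 * c + m * c) ≤ m ^ 2 * e :=
  calc m * (3 * c + m * c) = m * (3 + m) * c := by ring
    _ ≤ m * (4 * m) * c := by gcongr; linarith
    _ = m ^ 2 * (4 * c) := by ring
    _ ≤ m ^ 2 * e := by gcongr

/-- Passing to the density `ρ + s ε` makes the blocks independent, at the price of a lead of `2 √L`
per block. -/
lemma eventually_annealed_deviation_le {ν : ℝ} (hν : 0 < ν) (hdrift : E.NoDriftIn ν)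
    (hcover : E.Covering ν) {pE pO : ℝ} (hp : pE ≤ pO) : ∀ᶠ L : ℕ in atTop, ∀ ρ ∈ Set.Ioo a b,
      ∀ ε ∈ Set.Ico ((L : ℝ) ^ (-(1 / 32) : ℝ)) 1, ∀ s : ℤ, IsUnit s → ρ + s * ε ∈ Set.Ioo a b →
      ∀ m : ℕ, 1 ≤ m → ∀ y : ℝ, 0 ≤ y →
      (annealed (E.law ρ)).real
        {ω | m * (s * (L * E.finiteRangeSpeed pE pO (ρ + s * ε) L) + 2 * √L) + y ≤
          s * walkFrom pE pO 0 ω.1 ω.2 (m * L)} ≤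
        Real.exp (-(y ^ 2 / (2 * m * L ^ 2))) + m ^ 2 * Real.exp (-(L : ℝ) ^ (1 / 64 : ℝ)) := by
  filter_upwards [eventually_measure_walkFrom_le_law hν hdrift hcover hp,
    E.eventually_measure_compl_nearDensity_le (K := 6 * ν + 4) (by positivity),
    eventually_mul_pow_mul_exp_neg_rpow_le 4 0 (κ := 1) (p := 1 / 32) (q := 1 / 64)
      (by norm_num) (by norm_num) (by norm_num), eventually_ge_atTop 1]
    with L hblock hdensity herror hL ρ hρ ε hε s hs hρε m hm y hy
  have hm' : (1 : ℝ) ≤ m := Nat.one_le_cast.mpr hm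
  rw [pow_zero, mul_one, one_mul] at herror
  have lead_le : ((2 * coveringTime L : ℤ) : ℝ) ≤ 2 * √L := by
    have : (coveringTime L : ℝ) ≤ √L :=
      Real.le_sqrt_of_sq_le (by exact_mod_cast coveringTime_sq_le L)
    push_cast
    linarith
  have radius_le : ((blockWindow ν L + m * L : ℕ) : ℝ) ≤ (6 * ν + 4) * (m * L) := by
    have window_le : (blockWindow ν L : ℝ) ≤ (6 * ν + 3) * (m * L) :=
      (blockWindow_le hν.le hL).trans (by gcongr; exact le_mul_of_one_le_left (by positivity) hm')
    push_cast
    linarith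
  refine ENNReal.toReal_le_of_le_ofReal (by positivity) ?_
  calc _ ≤ annealed (E.law ρ) {ω | m * (s * (L * E.finiteRangeSpeed pE pO (ρ + s * ε) L) +
        ((2 * coveringTime L : ℤ) : ℝ)) + y ≤ s * walkFrom pE pO 0 ω.1 ω.2 (m * L)} := by
        refine measure_mono (Set.ofPred_subset_ofPred.mpr fun ω hω => le_trans ?_ hω)
        gcongr
    _ ≤ _ := E.annealed_deviation_le hρ hs (hblock ρ hρ ε hε s hs hρε) le_rfl hm hL hy
    _ ≤ ENNReal.ofReal (Real.exp (-(y ^ 2 / (2 * m * L ^ 2)))) + ENNReal.ofReal m *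
          (ENNReal.ofReal (3 * Real.exp (-(L : ℝ) ^ (1 / 32 : ℝ))) +
            ENNReal.ofReal (m * Real.exp (-(L : ℝ) ^ (1 / 32 : ℝ)))) := by
        rw [ENNReal.ofReal_natCast]
        gcongr
        exact hdensity ρ hρ ε hε m _ hm radius_le
    _ ≤ _ := by
        rw [← ENNReal.ofReal_add (by positivity) (by positivity),
          ← ENNReal.ofReal_mul (by positivity), ← ENNReal.ofReal_add (by positivity)
            (by positivity)]
        exact ENNReal.ofReal_le_ofReal
          (add_le_add le_rfl (mul_add_mul_le_sq_mul hm' (Real.exp_nonneg _) herror))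

end Environment

/-! ### Comparison of the speeds at different scales -/

lemma integral_walkFrom_le (P : Measure EnvPath) [IsProbabilityMeasure P] (pE pO : ℝ) {k n : ℕ}
    (hkn : k ≤ n) {A : ℝ} (hA : -n ≤ A) :
    ∫ ω, (walkFrom pE pO 0 ω.1 ω.2 n : ℝ) ∂(annealed P) ≤
      A + (n - k) + 2 * n * (annealed P).real {ω | A ≤ walkFrom pE pO 0 ω.1 ω.2 k} := by
  set B : Set WalkSpace := {ω | A ≤ walkFrom pE pO 0 ω.1 ω.2 k}
  have measurableSet_B : MeasurableSet B := measurableSet_le measurable_const (by fun_prop)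
  have integrable_indicator : Integrable (B.indicator fun _ => 2 * (n : ℝ)) (annealed P) :=
    (integrable_const _).indicator measurableSet_B
  have walk_le (ω : WalkSpace) : (walkFrom pE pO 0 ω.1 ω.2 n : ℝ) ≤
      A + (n - k) + B.indicator (fun _ => 2 * (n : ℝ)) ω := by
    by_cases hω : ω ∈ B
    · rw [Set.indicator_of_mem hω]
      have hkn' : (k : ℝ) ≤ n := Nat.cast_le.mpr hkn
      linarith [(abs_le.mp (abs_walkFrom_zero_le pE pO ω.1 ω.2 n)).2]
    · rw [Set.indicator_of_notMem hω]
      have lt_A : (walkFrom pE pO 0 ω.1 ω.2 k : ℝ) < A := not_le.mp hω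
      have increment_le : (walkFrom pE pO 0 ω.1 ω.2 n : ℝ) - walkFrom pE pO 0 ω.1 ω.2 k ≤ n - k :=
        mod_cast (abs_le.mp (abs_walkFrom_sub_walkFrom_le pE pO 0 ω.1 ω.2 hkn)).2
      linarith
  calc _ ≤ ∫ ω, (A + (n - k) + B.indicator (fun _ => 2 * (n : ℝ)) ω) ∂(annealed P) :=
        integral_mono (integrable_walkFrom P pE pO n)
          ((integrable_const _).add integrable_indicator) walk_le
    _ = _ := by
        rw [integral_add (integrable_const _) integrable_indicator, integral_const,
          integral_indicator_const _ measurableSet_B, probReal_univ, one_smul, smul_eq_mul,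
          mul_comm (2 * (n : ℝ))]

lemma mul_add_add_le_mul_speed {n m L v d g : ℝ} (hL : 0 < L) (hmn : m * L ≤ n)
    (hnm : n ≤ m * L + L) (hLn : L ^ 2 ≤ n) (hv : |v| ≤ 1) (hd : 0 ≤ d) (hg : 0 ≤ g) :
    m * (L * v + d) + m * L * g / 4 + L ≤ n * (v + (2 / L + d / L + g / 4)) := by
  have drift_le : m * L * v ≤ n * v + L := by nlinarith [(abs_le.mp hv).1]
  have boundary_le : 2 * L ≤ n * (2 / L) := by
    rw [mul_div_assoc', le_div_iff₀ hL]
    linarith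
  have lead_le : m * d ≤ n * (d / L) := by
    rw [mul_div_assoc', le_div_iff₀ hL]
    nlinarith
  have fluctuation_le : m * L * g / 4 ≤ n * (g / 4) := by
    rw [mul_div_assoc]
    gcongr
  linarith

lemma fluctuation_add_block_error_le {m L g e : ℝ} (hL : 0 < L) (hLm : L ≤ m) (hmL : m ≤ L ^ 3)
    (he : 0 ≤ e) :
    Real.exp (-((m * L * g / 4) ^ 2 / (2 * m * L ^ 2))) + m ^ 2 * e ≤
      Real.exp (-(L * g ^ 2 / 32)) + L ^ 6 * e := by
  have hm : 0 < m := hL.trans_le hLm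
  have exponent_eq : (m * L * g / 4) ^ 2 / (2 * m * L ^ 2) = m * g ^ 2 / 32 := by
    field_simp
    ring
  have sq_le : m ^ 2 ≤ L ^ 6 := (pow_le_pow_left₀ hm.le hmL 2).trans_eq (pow_mul L 3 2).symm
  rw [exponent_eq]
  gcongr

lemma eventually_speed_error_le : ∀ᶠ L : ℕ in atTop,
    2 / (L : ℝ) + 2 * √L / L + (L : ℝ) ^ (-(1 / 32) : ℝ) / 4 +
      2 * (Real.exp (-(L * ((L : ℝ) ^ (-(1 / 32) : ℝ)) ^ 2 / 32)) +
        L ^ 6 * Real.exp (-(L : ℝ) ^ (1 / 64 : ℝ))) ≤ (L : ℝ) ^ (-(1 / 32) : ℝ) := by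
  filter_upwards [(isLittleO_rpow_rpow_natCast (show (-(1 / 2) : ℝ) < -(1 / 32) by norm_num)).def
      (show (0 : ℝ) < 1 / 16 by norm_num),
    eventually_mul_pow_mul_exp_neg_rpow_le 1 1 (κ := 1 / 32) (p := 15 / 16) (q := 1 / 64)
      (by norm_num) (by norm_num) (by norm_num),
    eventually_mul_pow_mul_exp_neg_rpow_le 1 7 (κ := 1) (p := 1 / 64) (q := 1 / 128)
      (by norm_num) (by norm_num) (by norm_num), eventually_gt_atTop 0]
    with L hroot hfluct hblocks hL
  have hL' : (0 : ℝ) < L := Nat.cast_pos.mpr hL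
  have exp_le_one (q : ℝ) : Real.exp (-(L : ℝ) ^ q) ≤ 1 :=
    Real.exp_le_one_iff.mpr (neg_nonpos.mpr (by positivity))
  have sqrt_div : √(L : ℝ) / L = (L : ℝ) ^ (-(1 / 2) : ℝ) := by
    rw [Real.sqrt_eq_rpow, ← Real.rpow_sub_one hL'.ne']
    norm_num
  have inv_le : 1 / (L : ℝ) ≤ √(L : ℝ) / L := by
    gcongr
    exact Real.one_le_sqrt.mpr (Nat.one_le_cast.mpr hL)
  have mul_gap_sq : (L : ℝ) * ((L : ℝ) ^ (-(1 / 32) : ℝ)) ^ 2 = (L : ℝ) ^ (15 / 16 : ℝ) := by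
    rw [← Real.rpow_mul_natCast hL'.le, ← Real.rpow_one_add' hL'.le (by norm_num)]
    norm_num
  have fluctuation_le : Real.exp (-(L * ((L : ℝ) ^ (-(1 / 32) : ℝ)) ^ 2 / 32)) ≤ 1 / L := by
    rw [le_div_iff₀ hL', mul_gap_sq]
    have := hfluct.trans (exp_le_one _)
    ring_nf at this ⊢
    exact this
  have blocks_le : (L : ℝ) ^ 6 * Real.exp (-(L : ℝ) ^ (1 / 64 : ℝ)) ≤ 1 / L := by
    rw [le_div_iff₀ hL']
    have := hblocks.trans (exp_le_one _)
    ring_nf at this ⊢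
    exact this
  rw [Real.norm_of_nonneg (by positivity), Real.norm_of_nonneg (by positivity), ← sqrt_div]
    at hroot
  have two_div : 2 / (L : ℝ) = 2 * (1 / L) := by ring
  rw [mul_div_assoc, two_div]
  have gap_nonneg : 0 ≤ (L : ℝ) ^ (-(1 / 32) : ℝ) := by positivity
  linarith

namespace Environment

variable {a b : ℝ} (E : Environment a b)

lemma integral_annealed_law_mono {ρ ρ' : ℝ} (hρ : ρ ∈ Set.Ioo a b) (hρ' : ρ' ∈ Set.Ioo a b)
    (hle : ρ' ≤ ρ) {f : WalkSpace → ℝ} (hf : Measurable f) (hf0 : ∀ ω, 0 ≤ f ω)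
    (hint : Integrable f (annealed (E.law ρ))) (hmono : ∀ u, Monotone fun η => f (η, u)) :
    ∫ ω, f ω ∂(annealed (E.law ρ')) ≤ ∫ ω, f ω ∂(annealed (E.law ρ)) := by
  rw [integral_eq_lintegral_of_nonneg_ae (ae_of_all _ hf0) hf.aestronglyMeasurable,
    integral_eq_lintegral_of_nonneg_ae (ae_of_all _ hf0) hf.aestronglyMeasurable]
  refine ENNReal.toReal_mono ?_ ?_
  · rw [← ofReal_integral_eq_lintegral_ofReal hint (ae_of_all _ hf0)]
    exact ENNReal.ofReal_ne_top
  · rw [lintegral_annealed _ hf.ennreal_ofReal, lintegral_annealed _ hf.ennreal_ofReal]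
    exact lintegral_mono fun u => E.lintegral_law_mono hρ hρ' hle (by fun_prop)
      fun η η' h => ENNReal.ofReal_le_ofReal (hmono u h)

lemma monotoneOn_finiteRangeSpeed {pE pO : ℝ} (hp : pE ≤ pO) (L : ℕ) :
    MonotoneOn (fun ρ => E.finiteRangeSpeed pE pO ρ L) (Set.Ioo a b) := by
  intro ρ' hρ' ρ hρ hle
  rcases L.eq_zero_or_pos with rfl | hL
  · simp [finiteRangeSpeed]
  have integrable (ρ : ℝ) := integrable_walkFrom (E.law ρ) pE pO L
  have shifted_le := E.integral_annealed_law_mono hρ hρ' hle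
    (f := fun ω => walkFrom pE pO 0 ω.1 ω.2 L + L) (by fun_prop)
    (fun ω => neg_le_iff_add_nonneg.mp (abs_le.mp (abs_walkFrom_zero_le pE pO ω.1 ω.2 L)).1)
    ((integrable ρ).add (integrable_const _)) fun u η η' h => by
      have := walkFrom_le_walkFrom hp (x := 0) le_rfl (by simp) u (n := L)
        (r := L) (by simp) fun s _ x _ => h s x
      simpa using this
  rw [integral_add (integrable _) (integrable_const _),
    integral_add (integrable _) (integrable_const _), E.integral_walkFrom_eq,
    E.integral_walkFrom_eq] at shifted_le
  simp only [integral_const, probReal_univ, one_smul, add_le_add_iff_right] at shifted_le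
  exact le_of_mul_le_mul_left shifted_le (Nat.cast_pos.mpr hL)

lemma finiteRangeSpeed_le_of_annealed_le {pE pO ρ v d g p : ℝ} {m L n : ℕ} (hL : 0 < L)
    (hLn : L ^ 2 ≤ n) (hmn : m * L ≤ n) (hnm : n ≤ m * L + L) (hv : |v| ≤ 1) (hd : 0 ≤ d)
    (hg : 0 ≤ g)
    (h : (annealed (E.law ρ)).real
      {ω | m * (L * v + d) + m * L * g / 4 ≤ walkFrom pE pO 0 ω.1 ω.2 (m * L)} ≤ p) :
    E.finiteRangeSpeed pE pO ρ n ≤ v + (2 / L + d / L + g / 4) + 2 * p := by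
  have hL' : (0 : ℝ) < L := Nat.cast_pos.mpr hL
  have hn' : (0 : ℝ) < n := Nat.cast_pos.mpr ((pow_pos hL 2).trans_le hLn)
  have hmn' : (m : ℝ) * L ≤ n := mod_cast hmn
  have hnm' : (n : ℝ) ≤ m * L + L := mod_cast hnm
  have threshold_ge : -(n : ℝ) ≤ m * (L * v + d) + m * L * g / 4 := by
    have drift_ge : -(n : ℝ) ≤ m * L * v := by
      nlinarith [(abs_le.mp hv).1, (by positivity : 0 ≤ (m : ℝ) * L)]
    have lead_nonneg : 0 ≤ m * d + m * L * g / 4 := by positivity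
    linarith
  have mean_le := integral_walkFrom_le (E.law ρ) pE pO hmn threshold_ge
  rw [E.integral_walkFrom_eq, Nat.cast_mul] at mean_le
  have threshold_le := mul_add_add_le_mul_speed hL' hmn' hnm' (mod_cast hLn) hv hd hg
  have scaled_h := mul_le_mul_of_nonneg_left h (by positivity : 0 ≤ 2 * (n : ℝ))
  refine le_of_mul_le_mul_left ?_ hn'
  linarith

lemma eventually_finiteRangeSpeed_le_of_le_pow {ν : ℝ} (hν : 0 < ν) (hdrift : E.NoDriftIn ν)
    (hcover : E.Covering ν) {pE pO : ℝ} (hp : pE ≤ pO) : ∀ᶠ L : ℕ in atTop, ∀ ρ ∈ Set.Ioo a b,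
      ρ + (L : ℝ) ^ (-(1 / 32) : ℝ) ∈ Set.Ioo a b → ∀ n, L ^ 2 ≤ n → n ≤ L ^ 4 →
      E.finiteRangeSpeed pE pO ρ n ≤
        E.finiteRangeSpeed pE pO (ρ + (L : ℝ) ^ (-(1 / 32) : ℝ)) L +
          (L : ℝ) ^ (-(1 / 32) : ℝ) := by
  filter_upwards [E.eventually_annealed_deviation_le hν hdrift hcover hp, eventually_speed_error_le,
    eventually_gt_atTop 1] with L hdev herror hL ρ hρ hρg n hLn hnL
  set g : ℝ := (L : ℝ) ^ (-(1 / 32) : ℝ)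
  have hL' : (0 : ℝ) < L := Nat.cast_pos.mpr (by omega)
  obtain ⟨m, hm⟩ : ∃ m, m = n / L := ⟨_, rfl⟩
  have L_le_m : L ≤ m := by
    rw [hm, Nat.le_div_iff_mul_le (by omega), ← pow_two]
    exact hLn
  have m_le : m ≤ L ^ 3 := hm ▸ Nat.div_le_of_le_mul (hnL.trans_eq (pow_succ' L 3))
  have mL_le : m * L ≤ n := hm ▸ Nat.div_mul_le_self n L
  have le_mL : n ≤ m * L + L := hm ▸ (Nat.lt_div_mul_add (by omega)).le
  have g_lt_one : g < 1 := Real.rpow_lt_one_of_one_lt_of_neg (Nat.one_lt_cast.mpr hL) (by norm_num)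
  have deviation := hdev ρ hρ g ⟨le_rfl, g_lt_one⟩ 1 isUnit_one (by simpa using hρg) m (by omega)
    (m * L * g / 4) (by positivity)
  simp only [Int.cast_one, one_mul] at deviation
  have probability_le := deviation.trans (fluctuation_add_block_error_le hL'
    (mod_cast L_le_m : (L : ℝ) ≤ m) (mod_cast m_le) (Real.exp_nonneg _))
  linarith [E.finiteRangeSpeed_le_of_annealed_le (by omega) hLn mL_le le_mL
    (E.abs_finiteRangeSpeed_le pE pO (ρ + g) L) (by positivity) (by positivity) probability_le]

/-- The bound propagates from the scales in `[L ^ 2, L ^ 4]` to all larger ones by passing from `L`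
to `L ^ 2`, since the increments of the density decrease at least geometrically along this
sequence. -/
lemma eventually_finiteRangeSpeed_le {ν : ℝ} (hν : 0 < ν) (hdrift : E.NoDriftIn ν)
    (hcover : E.Covering ν) {pE pO : ℝ} (hp : pE ≤ pO) : ∀ᶠ L : ℕ in atTop, ∀ n, L ^ 2 ≤ n →
      ∀ ρ ∈ Set.Ioo a b, ρ + 2 * (L : ℝ) ^ (-(1 / 32) : ℝ) ∈ Set.Ioo a b →
      E.finiteRangeSpeed pE pO ρ n ≤
        E.finiteRangeSpeed pE pO (ρ + 2 * (L : ℝ) ^ (-(1 / 32) : ℝ)) L +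
          2 * (L : ℝ) ^ (-(1 / 32) : ℝ) := by
  have gap_le_half : ∀ᶠ L : ℕ in atTop, (L : ℝ) ^ (-(1 / 32) : ℝ) ≤ 1 / 2 :=
    ((tendsto_rpow_neg_atTop (by norm_num)).comp
      tendsto_natCast_atTop_atTop).eventually_le_const (by norm_num)
  obtain ⟨L₀, hL₀⟩ := eventually_atTop.mp ((E.eventually_finiteRangeSpeed_le_of_le_pow hν hdrift
    hcover hp).and (gap_le_half.and (eventually_ge_atTop 2)))
  refine eventually_atTop.mpr ⟨L₀, fun L hL n hLn => ?_⟩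
  induction hk : n - L using Nat.strong_induction_on generalizing L with
  | _ k ih =>
    intro ρ hρ hρg
    obtain ⟨one_scale, gap_le, two_le⟩ := hL₀ L hL
    set g : ℝ := (L : ℝ) ^ (-(1 / 32) : ℝ) with hg
    have g_nonneg : 0 ≤ g := by positivity
    have mem_Ioo (x : ℝ) (hx0 : 0 ≤ x) (hx : x ≤ 2 * g) : ρ + x ∈ Set.Ioo a b :=
      ⟨by linarith [hρ.1], by linarith [hρg.2]⟩
    have mono (L : ℕ) {x y : ℝ} (hx : 0 ≤ x) (hxy : x ≤ y) (hy : y ≤ 2 * g) :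
        E.finiteRangeSpeed pE pO (ρ + x) L ≤ E.finiteRangeSpeed pE pO (ρ + y) L :=
      E.monotoneOn_finiteRangeSpeed hp L (mem_Ioo x hx (hxy.trans hy))
        (mem_Ioo y (hx.trans hxy) hy) (by linarith)
    have g_mem := mem_Ioo g g_nonneg (by linarith)
    rcases le_or_gt n (L ^ 4) with hn | hn
    · linarith [one_scale ρ hρ g_mem n hLn hn, mono L g_nonneg (by linarith) le_rfl]
    · have gap_sq : ((L ^ 2 : ℕ) : ℝ) ^ (-(1 / 32) : ℝ) = g ^ 2 := by
        rw [hg, Nat.cast_pow, Real.rpow_pow_comm (by positivity)]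
      have two_mul_sq_le : 2 * g ^ 2 ≤ g := by nlinarith
      have L_lt : L < L ^ 2 := by nlinarith
      have large_scales := ih (n - L ^ 2) (by omega) (L ^ 2) (by omega)
        (by rw [← pow_mul]; exact hn.le) rfl ρ hρ
      rw [gap_sq] at large_scales
      have next_scale := one_scale (ρ + g) g_mem (by rwa [add_assoc, ← two_mul]) (L ^ 2) le_rfl
        (Nat.pow_le_pow_right (by omega) (by norm_num))
      rw [add_assoc ρ g g, ← two_mul] at next_scale
      linarith [large_scales (mem_Ioo _ (by positivity) (by linarith)),
        mono (L ^ 2) (by positivity) two_mul_sq_le (by linarith)]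

end Environment

/-! ### Existence of the limiting speeds -/

namespace Environment

variable {a b : ℝ} (E : Environment a b)

section

variable (pE pO ρ : ℝ)

lemma isBoundedUnder_le_finiteRangeSpeed :
    IsBoundedUnder (· ≤ ·) atTop (E.finiteRangeSpeed pE pO ρ) :=
  isBoundedUnder_of ⟨1, fun L => (abs_le.mp (E.abs_finiteRangeSpeed_le pE pO ρ L)).2⟩

lemma isBoundedUnder_ge_finiteRangeSpeed :
    IsBoundedUnder (· ≥ ·) atTop (E.finiteRangeSpeed pE pO ρ) :=
  isBoundedUnder_of ⟨-1, fun L => (abs_le.mp (E.abs_finiteRangeSpeed_le pE pO ρ L)).1⟩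

end

variable {E} {pE pO : ℝ}

lemma tendsto_finiteRangeSpeed {ρ : ℝ} (hρ : ρ ∈ E.speedDomain pE pO) :
    Tendsto (E.finiteRangeSpeed pE pO ρ) atTop (𝓝 (E.speed pE pO ρ)) :=
  tendsto_nhds_limUnder hρ.2

lemma abs_speed_le {ρ : ℝ} (hρ : ρ ∈ E.speedDomain pE pO) : |E.speed pE pO ρ| ≤ 1 :=
  le_of_tendsto' (tendsto_finiteRangeSpeed hρ).abs (E.abs_finiteRangeSpeed_le pE pO ρ)

lemma monotoneOn_speed (hp : pE ≤ pO) :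
    MonotoneOn (E.speed pE pO) (E.speedDomain pE pO) := fun _ hρ _ hρ' hle =>
  le_of_tendsto_of_tendsto' (tendsto_finiteRangeSpeed hρ) (tendsto_finiteRangeSpeed hρ')
    fun L => E.monotoneOn_finiteRangeSpeed hp L hρ.1 hρ'.1 hle

lemma exists_monotone_eqOn_speed (hp : pE ≤ pO) :
    ∃ V : ℝ → ℝ, Monotone V ∧ Set.EqOn (E.speed pE pO) V (E.speedDomain pE pO) :=
  (monotoneOn_speed hp).exists_monotone_extension
    ⟨-1, Set.forall_mem_image.mpr fun _ hρ => (abs_le.mp (abs_speed_le hρ)).1⟩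
    ⟨1, Set.forall_mem_image.mpr fun _ hρ => (abs_le.mp (abs_speed_le hρ)).2⟩

lemma tendsto_speedPlus (hp : pE ≤ pO) (ρ : ℝ) :
    Tendsto (E.speed pE pO) (𝓝[E.speedDomain pE pO ∩ Set.Ioi ρ] ρ)
      (𝓝 (E.speedPlus pE pO ρ)) := by
  obtain ⟨V, hV, heq⟩ := exists_monotone_eqOn_speed (E := E) hp
  exact tendsto_nhds_limUnder ⟨_, ((hV.tendsto_nhdsGT ρ).mono_left
    (nhdsWithin_mono ρ Set.inter_subset_right)).congr'
      (eventually_mem_nhdsWithin.mono fun _ h => (heq h.1).symm)⟩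

lemma tendsto_speedMinus (hp : pE ≤ pO) (ρ : ℝ) :
    Tendsto (E.speed pE pO) (𝓝[E.speedDomain pE pO ∩ Set.Iio ρ] ρ)
      (𝓝 (E.speedMinus pE pO ρ)) := by
  obtain ⟨V, hV, heq⟩ := exists_monotone_eqOn_speed (E := E) hp
  exact tendsto_nhds_limUnder ⟨_, ((hV.tendsto_nhdsLT ρ).mono_left
    (nhdsWithin_mono ρ Set.inter_subset_right)).congr'
      (eventually_mem_nhdsWithin.mono fun _ h => (heq h.1).symm)⟩

section

variable {ν : ℝ} (hν : 0 < ν) (hdrift : E.NoDriftIn ν) (hcover : E.Covering ν) (hp : pE ≤ pO)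

include hν hdrift hcover hp

lemma limsup_finiteRangeSpeed_le_liminf {ρ ρ' : ℝ} (hρ : ρ ∈ Set.Ioo a b)
    (hρ' : ρ' ∈ Set.Ioo a b) (hlt : ρ < ρ') :
    limsup (E.finiteRangeSpeed pE pO ρ) atTop ≤ liminf (E.finiteRangeSpeed pE pO ρ') atTop := by
  have tendsto_gap : Tendsto (fun L : ℕ => 2 * (L : ℝ) ^ (-(1 / 32) : ℝ)) atTop (𝓝 0) := by
    simpa using ((tendsto_rpow_neg_atTop (show (0 : ℝ) < 1 / 32 by norm_num)).comp
      tendsto_natCast_atTop_atTop).const_mul 2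
  refine le_of_forall_pos_le_add fun x hx => ?_
  rw [← sub_le_iff_le_add]
  refine le_liminf_of_le (E.isBoundedUnder_le_finiteRangeSpeed pE pO ρ').isCoboundedUnder_ge ?_
  filter_upwards [E.eventually_finiteRangeSpeed_le hν hdrift hcover hp,
    tendsto_gap.eventually_le_const (sub_pos.mpr hlt), tendsto_gap.eventually_le_const hx]
    with L speed_le gap_le_sub gap_le
  have gap_nonneg : 0 ≤ 2 * (L : ℝ) ^ (-(1 / 32) : ℝ) := by positivity
  have shifted_mem : ρ + 2 * (L : ℝ) ^ (-(1 / 32) : ℝ) ∈ Set.Ioo a b :=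
    ⟨by linarith [hρ.1], by linarith [hρ'.2]⟩
  have limsup_le : limsup (E.finiteRangeSpeed pE pO ρ) atTop ≤
      E.finiteRangeSpeed pE pO (ρ + 2 * (L : ℝ) ^ (-(1 / 32) : ℝ)) L +
        2 * (L : ℝ) ^ (-(1 / 32) : ℝ) :=
    limsup_le_of_le (E.isBoundedUnder_ge_finiteRangeSpeed pE pO ρ).isCoboundedUnder_le <|
      (eventually_ge_atTop (L ^ 2)).mono fun n hn => speed_le n hn ρ hρ shifted_mem
  have speed_mono : E.finiteRangeSpeed pE pO (ρ + 2 * (L : ℝ) ^ (-(1 / 32) : ℝ)) L ≤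
      E.finiteRangeSpeed pE pO ρ' L :=
    E.monotoneOn_finiteRangeSpeed hp L shifted_mem hρ' (by linarith)
  linarith

lemma monotoneOn_limsup_finiteRangeSpeed :
    MonotoneOn (fun ρ => limsup (E.finiteRangeSpeed pE pO ρ) atTop) (Set.Ioo a b) := by
  intro ρ hρ ρ' hρ' hle
  rcases hle.lt_or_eq with hlt | rfl
  · exact (limsup_finiteRangeSpeed_le_liminf hν hdrift hcover hp hρ hρ' hlt).trans
      (liminf_le_limsup (E.isBoundedUnder_le_finiteRangeSpeed pE pO ρ')
        (E.isBoundedUnder_ge_finiteRangeSpeed pE pO ρ'))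
  · exact le_rfl

lemma mem_speedDomain_of_continuousWithinAt {ρ : ℝ} (hρ : ρ ∈ Set.Ioo a b)
    (hcont : ContinuousWithinAt (fun ρ => limsup (E.finiteRangeSpeed pE pO ρ) atTop)
      (Set.Ioo a b) ρ) :
    ρ ∈ E.speedDomain pE pO := by
  refine ⟨hρ, limsup (E.finiteRangeSpeed pE pO ρ) atTop,
    tendsto_of_le_liminf_of_limsup_le ?_ le_rfl (E.isBoundedUnder_le_finiteRangeSpeed pE pO ρ)
      (E.isBoundedUnder_ge_finiteRangeSpeed pE pO ρ)⟩
  have : (𝓝[Set.Ioo a ρ] ρ).NeBot := right_nhdsWithin_Ioo_neBot hρ.1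
  refine le_of_tendsto (hcont.tendsto.mono_left
    (nhdsWithin_mono _ (Set.Ioo_subset_Ioo_right hρ.2.le))) ?_
  exact eventually_mem_nhdsWithin.mono fun r hr =>
    limsup_finiteRangeSpeed_le_liminf hν hdrift hcover hp ⟨hr.1, hr.2.trans hρ.2⟩ hρ hr.2

lemma nonempty_speedDomain_inter_Ioo {x y : ℝ} (hx : a ≤ x) (hy : y ≤ b) (hxy : x < y) :
    (E.speedDomain pE pO ∩ Set.Ioo x y).Nonempty := by
  obtain ⟨ρ, hρ, hxρ, hρy⟩ := ((monotoneOn_limsup_finiteRangeSpeed hν hdrift hcover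
    hp).countable_not_continuousWithinAt.dense_compl ℝ).exists_between hxy
  have hρJ : ρ ∈ Set.Ioo a b := ⟨hx.trans_lt hxρ, hρy.trans_le hy⟩
  exact ⟨ρ, mem_speedDomain_of_continuousWithinAt hν hdrift hcover hp hρJ
    (not_not.mp fun hcont => hρ ⟨hρJ, hcont⟩), hxρ, hρy⟩

lemma neBot_nhdsWithin_speedDomain_Ioi {ρ : ℝ} (hρ : ρ ∈ Set.Ioo a b) :
    (𝓝[E.speedDomain pE pO ∩ Set.Ioi ρ] ρ).NeBot := by
  rw [← mem_closure_iff_nhdsWithin_neBot, Real.mem_closure_iff]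
  intro x hx
  obtain ⟨r, hr, hρr, hrx⟩ := nonempty_speedDomain_inter_Ioo hν hdrift hcover hp hρ.1.le
    (min_le_left b (ρ + x)) (lt_min hρ.2 (lt_add_of_pos_right ρ hx))
  refine ⟨r, ⟨hr, hρr⟩, abs_lt.mpr ?_⟩
  constructor <;> linarith [min_le_right b (ρ + x)]

lemma neBot_nhdsWithin_speedDomain_Iio {ρ : ℝ} (hρ : ρ ∈ Set.Ioo a b) :
    (𝓝[E.speedDomain pE pO ∩ Set.Iio ρ] ρ).NeBot := by
  rw [← mem_closure_iff_nhdsWithin_neBot, Real.mem_closure_iff]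
  intro x hx
  obtain ⟨r, hr, hxr, hrρ⟩ := nonempty_speedDomain_inter_Ioo hν hdrift hcover hp
    (le_max_left a (ρ - x)) hρ.2.le (max_lt hρ.1 (sub_lt_self ρ hx))
  refine ⟨r, ⟨hr, hrρ⟩, abs_lt.mpr ?_⟩
  constructor <;> linarith [le_max_right a (ρ - x)]

lemma abs_speedPlus_le {ρ : ℝ} (hρ : ρ ∈ Set.Ioo a b) : |E.speedPlus pE pO ρ| ≤ 1 :=
  have := neBot_nhdsWithin_speedDomain_Ioi hν hdrift hcover hp hρ
  le_of_tendsto (tendsto_speedPlus hp ρ).abs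
    (eventually_mem_nhdsWithin.mono fun _ hr => abs_speed_le hr.1)

lemma abs_speedMinus_le {ρ : ℝ} (hρ : ρ ∈ Set.Ioo a b) : |E.speedMinus pE pO ρ| ≤ 1 :=
  have := neBot_nhdsWithin_speedDomain_Iio hν hdrift hcover hp hρ
  le_of_tendsto (tendsto_speedMinus hp ρ).abs
    (eventually_mem_nhdsWithin.mono fun _ hr => abs_speed_le hr.1)

end

end Environment

/-! ### One-sided deviation bounds -/

lemma mul_add_add_add_le_mul_add {n m L w v δ : ℝ} (hL : 0 < L) (hmn : m * L ≤ n)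
    (hnm : n ≤ m * L + L) (hm : 0 ≤ m) (hw : |w| ≤ 1) (hδ : 0 < δ) (hv : v ≤ w + δ / 4)
    (hroot : 32 ≤ √L * δ) (hn : 12 * L ≤ n * δ) :
    m * (L * v + 2 * √L) + δ * n / 2 + L ≤ n * (w + δ) := by
  have drift_le : m * L * v ≤ n * w + L + n * (δ / 4) := by
    have : m * L * v ≤ m * L * (w + δ / 4) := by gcongr
    nlinarith [(abs_le.mp hw).1]
  have lead_le : m * (2 * √L) ≤ n * (δ / 16) :=
    calc m * (2 * √L) = m * √L * 32 / 16 := by ring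
      _ ≤ m * √L * (√L * δ) / 16 := by gcongr
      _ = m * L * (δ / 16) := by linear_combination m * δ / 16 * Real.mul_self_sqrt hL.le
      _ ≤ n * (δ / 16) := by gcongr
  linarith

lemma fluctuation_add_blocks_error_le {n m L δ e : ℝ} (hL : 0 < L) (hm : 0 < m) (hmn : m * L ≤ n)
    (hn : 6 * L ≤ n) (he : 0 ≤ e) :
    Real.exp (-((δ * n / 2) ^ 2 / (2 * m * L ^ 2))) + m ^ 2 * e ≤
      ((⌈n / L⌉₊ : ℝ) - 1) ^ 2 * (4 * e) + Real.exp (-(δ ^ 2 * n) / (2 ^ 9 * L)) := by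
  have hn0 : 0 < n := by linarith
  have m_le : m ≤ 2 * ((⌈n / L⌉₊ : ℝ) - 1) := by
    have le_ceil : n / L ≤ ⌈n / L⌉₊ := Nat.le_ceil _
    linarith [(le_div_iff₀ hL).mpr hmn, (le_div_iff₀ hL).mpr hn]
  have blocks_le : m ^ 2 * e ≤ ((⌈n / L⌉₊ : ℝ) - 1) ^ 2 * (4 * e) :=
    calc m ^ 2 * e ≤ (2 * ((⌈n / L⌉₊ : ℝ) - 1)) ^ 2 * e := by gcongr
      _ = ((⌈n / L⌉₊ : ℝ) - 1) ^ 2 * (4 * e) := by ring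
  have exponent_le : δ ^ 2 * n / (2 ^ 9 * L) ≤ (δ * n / 2) ^ 2 / (2 * m * L ^ 2) := by
    rw [div_le_div_iff₀ (by positivity) (by positivity)]
    calc δ ^ 2 * n * (2 * m * L ^ 2) = 2 * (δ ^ 2 * n * L) * (m * L) := by ring
      _ ≤ 128 * (δ ^ 2 * n * L) * n := by gcongr; norm_num
      _ = (δ * n / 2) ^ 2 * (2 ^ 9 * L) := by ring
  rw [add_comm, neg_div]
  gcongr

lemma abs_mul_walkFrom_div_le {s : ℤ} (hs : IsUnit s) (pE pO : ℝ) (η : EnvPath)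
    (u : ℕ → unitInterval) (n : ℕ) : |s * (walkFrom pE pO 0 η u n / n : ℝ)| ≤ 1 := by
  have abs_s : |(s : ℝ)| = 1 := by exact_mod_cast Int.isUnit_iff_abs_eq.mp hs
  rw [abs_mul, abs_s, one_mul, abs_div, Nat.abs_cast]
  exact div_le_one_of_le₀ (abs_walkFrom_zero_le pE pO η u n) n.cast_nonneg

lemma mul_walkFrom_le_mul_walkFrom_add {s : ℤ} (hs : IsUnit s) (pE pO : ℝ) (η : EnvPath)
    (u : ℕ → unitInterval) {k n : ℕ} (hkn : k ≤ n) :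
    (s * walkFrom pE pO 0 η u n : ℝ) ≤ s * walkFrom pE pO 0 η u k + (n - k) := by
  have increment := abs_le.mp (abs_walkFrom_sub_walkFrom_le pE pO 0 η u hkn)
  have : s * walkFrom pE pO 0 η u n ≤ s * walkFrom pE pO 0 η u k + (n - k) := by
    rcases Int.isUnit_iff.mp hs with rfl | rfl <;> linarith [increment.1, increment.2]
  exact_mod_cast this

lemma mul_add_add_le_mul_walkFrom {s : ℤ} (hs : IsUnit s) (pE pO : ℝ) (η : EnvPath)
    (u : ℕ → unitInterval) {L n : ℕ} (hL : 0 < L) {v w δ : ℝ} (hw : |w| ≤ 1) (hδ : 0 < δ)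
    (hv : s * v ≤ w + δ / 4) (hroot : 32 ≤ √L * δ) (hn : 12 * L ≤ n * δ)
    (hwalk : w + δ ≤ s * (walkFrom pE pO 0 η u n / n)) :
    (n / L : ℕ) * (s * (L * v) + 2 * √L) + δ * n / 2 ≤ s * walkFrom pE pO 0 η u (n / L * L) := by
  have hL' : (0 : ℝ) < L := Nat.cast_pos.mpr hL
  have hn' : (0 : ℝ) < n := pos_of_mul_pos_left (by linarith) hδ.le
  have mL_le : ((n / L : ℕ) : ℝ) * L ≤ n := mod_cast Nat.div_mul_le_self n L
  have le_mL : (n : ℝ) ≤ (n / L : ℕ) * L + L := mod_cast (Nat.lt_div_mul_add hL).le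
  rw [mul_div_assoc', le_div_iff₀' hn'] at hwalk
  have increment_le := mul_walkFrom_le_mul_walkFrom_add hs pE pO η u (Nat.div_mul_le_self n L)
  have threshold_le := mul_add_add_add_le_mul_add hL' mL_le le_mL (Nat.cast_nonneg _) hw hδ hv
    hroot hn
  rw [Nat.cast_mul] at increment_le
  linarith

namespace Environment

variable {a b : ℝ} {E : Environment a b} {pE pO ν : ℝ} (hν : 0 < ν) (hdrift : E.NoDriftIn ν)
  (hcover : E.Covering ν) (hp : pE ≤ pO)

include hν hdrift hcover hp

lemma eventually_deviation_le_of_le_two {ρ r : ℝ} {s : ℤ} (hρ : ρ ∈ Set.Ioo a b)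
    (hr : r ∈ E.speedDomain pE pO) (hs : IsUnit s) (hρr : s * (r - ρ) ∈ Set.Ioo (0 : ℝ) 1)
    {δ w : ℝ} (hδ : 0 < δ) (hδ2 : δ ≤ 2) (hw : |w| ≤ 1)
    (hspeed : s * E.speed pE pO r < w + δ / 4) :
    ∀ᶠ L : ℕ in atTop, ∀ n : ℕ, 12 * (L : ℝ) / δ ≤ n →
      (annealed (E.law ρ)).real {ω | w + δ ≤ s * (walkFrom pE pO 0 ω.1 ω.2 n / n)} ≤
        ((⌈(n : ℝ) / L⌉₊ : ℝ) - 1) ^ 2 * Real.exp (-(L : ℝ) ^ (1 / 400 : ℝ)) +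
          Real.exp (-(δ ^ 2 * n) / (2 ^ 9 * L)) := by
  have tendsto_gap : Tendsto (fun L : ℕ => (L : ℝ) ^ (-(1 / 32) : ℝ)) atTop (𝓝 0) :=
    (tendsto_rpow_neg_atTop (by norm_num)).comp tendsto_natCast_atTop_atTop
  have tendsto_sqrt : Tendsto (fun L : ℕ => √(L : ℝ)) atTop atTop :=
    Real.tendsto_sqrt_atTop.comp tendsto_natCast_atTop_atTop
  filter_upwards [E.eventually_annealed_deviation_le hν hdrift hcover hp,
    tendsto_gap.eventually_le_const hρr.1,
    ((tendsto_finiteRangeSpeed hr).const_mul (s : ℝ)).eventually_le_const hspeed,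
    tendsto_sqrt.eventually_ge_atTop (32 / δ), eventually_gt_atTop 0,
    eventually_mul_pow_mul_exp_neg_rpow_le 4 0 (κ := 1) (p := 1 / 64) (q := 1 / 400)
      (by norm_num) (by norm_num) (by norm_num)]
    with L deviation gap_le speed_le sqrt_ge hL four_mul_exp_le n hn
  rw [pow_zero, mul_one, one_mul] at four_mul_exp_le
  rw [div_le_iff₀ hδ] at hn sqrt_ge
  have hL' : (0 : ℝ) < L := Nat.cast_pos.mpr hL
  have six_mul_le : 6 * (L : ℝ) ≤ n := by nlinarith
  have m_pos : 1 ≤ n / L :=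
    (Nat.one_le_div_iff hL).mpr (Nat.cast_le.mp (by linarith : (L : ℝ) ≤ n))
  have mL_le : ((n / L : ℕ) : ℝ) * L ≤ n := mod_cast Nat.div_mul_le_self n L
  have r_eq : ρ + s * (s * (r - ρ)) = r := by
    have : (s : ℝ) * s = 1 := mod_cast Int.isUnit_mul_self hs
    linear_combination (r - ρ) * this
  have deviation_le := deviation ρ hρ _ ⟨gap_le, hρr.2⟩ s hs (by rw [r_eq]; exact hr.1) (n / L)
    m_pos (δ * n / 2) (by positivity)
  rw [r_eq] at deviation_le
  exact (measureReal_mono (Set.ofPred_subset_ofPred.mpr fun ω hω =>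
    mul_add_add_le_mul_walkFrom hs pE pO ω.1 ω.2 hL hw hδ speed_le sqrt_ge hn hω)).trans <|
    deviation_le.trans <| (fluctuation_add_blocks_error_le hL' (Nat.cast_pos.mpr m_pos) mL_le
      six_mul_le (Real.exp_nonneg _)).trans (by gcongr)

lemma eventually_deviation_le {ρ r : ℝ} {s : ℤ} (hρ : ρ ∈ Set.Ioo a b)
    (hr : r ∈ E.speedDomain pE pO) (hs : IsUnit s) (hρr : s * (r - ρ) ∈ Set.Ioo (0 : ℝ) 1)
    {δ w : ℝ} (hδ : 0 < δ) (hw : |w| ≤ 1) (hspeed : s * E.speed pE pO r < w + δ / 4) :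
    ∀ᶠ L : ℕ in atTop, ∀ n : ℕ, 12 * (L : ℝ) / δ ≤ n →
      (annealed (E.law ρ)).real {ω | w + δ ≤ s * (walkFrom pE pO 0 ω.1 ω.2 n / n)} ≤
        ((⌈(n : ℝ) / L⌉₊ : ℝ) - 1) ^ 2 * Real.exp (-(L : ℝ) ^ (1 / 400 : ℝ)) +
          Real.exp (-(δ ^ 2 * n) / (2 ^ 9 * L)) := by
  rcases le_or_gt δ 2 with hδ2 | hδ2
  · exact eventually_deviation_le_of_le_two hν hdrift hcover hp hρ hr hs hρr hδ hδ2 hw hspeed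
  · refine Eventually.of_forall fun L n _ => ?_
    have event_eq : {ω : WalkSpace | w + δ ≤ s * (walkFrom pE pO 0 ω.1 ω.2 n / n)} = ∅ :=
      Set.eq_empty_of_forall_notMem fun ω hω => by
        have := (abs_le.mp (abs_mul_walkFrom_div_le hs pE pO ω.1 ω.2 n)).2
        linarith [(abs_le.mp hw).1, show w + δ ≤ _ from hω]
    rw [event_eq, measureReal_empty]
    positivity

lemma eventually_upper_deviation_le {ρ δ : ℝ} (hρ : ρ ∈ Set.Ioo a b) (hδ : 0 < δ) :
    ∀ᶠ L : ℕ in atTop, ∀ n : ℕ, 12 * (L : ℝ) / δ ≤ n →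
      (annealed (E.law ρ)).real {ω | E.speedPlus pE pO ρ + δ ≤ walk pE pO ω.1 ω.2 n / n} ≤
        ((⌈(n : ℝ) / L⌉₊ : ℝ) - 1) ^ 2 * Real.exp (-(L : ℝ) ^ (1 / 400 : ℝ)) +
          Real.exp (-(δ ^ 2 * n) / (2 ^ 9 * L)) := by
  have := neBot_nhdsWithin_speedDomain_Ioi hν hdrift hcover hp hρ
  obtain ⟨r, ⟨hr, hρr⟩, speed_lt, r_lt⟩ := (eventually_mem_nhdsWithin.and
    (((tendsto_speedPlus (E := E) hp ρ).eventually_lt_const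
      (lt_add_of_pos_right _ (div_pos hδ four_pos))).and
      (mem_nhdsWithin_of_mem_nhds (Iio_mem_nhds (lt_add_one ρ))))).exists
  simpa [walk_eq_walkFrom] using eventually_deviation_le hν hdrift hcover hp hρ hr isUnit_one
    (by simpa [sub_lt_iff_lt_add'] using ⟨hρr, r_lt⟩) hδ
    (abs_speedPlus_le hν hdrift hcover hp hρ) (by simpa using speed_lt)

lemma eventually_lower_deviation_le {ρ δ : ℝ} (hρ : ρ ∈ Set.Ioo a b) (hδ : 0 < δ) :
    ∀ᶠ L : ℕ in atTop, ∀ n : ℕ, 12 * (L : ℝ) / δ ≤ n →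
      (annealed (E.law ρ)).real {ω | walk pE pO ω.1 ω.2 n / n ≤ E.speedMinus pE pO ρ - δ} ≤
        ((⌈(n : ℝ) / L⌉₊ : ℝ) - 1) ^ 2 * Real.exp (-(L : ℝ) ^ (1 / 400 : ℝ)) +
          Real.exp (-(δ ^ 2 * n) / (2 ^ 9 * L)) := by
  have := neBot_nhdsWithin_speedDomain_Iio hν hdrift hcover hp hρ
  obtain ⟨r, ⟨hr, hrρ⟩, lt_speed, lt_r⟩ := (eventually_mem_nhdsWithin.and
    (((tendsto_speedMinus (E := E) hp ρ).eventually_const_lt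
      (sub_lt_self _ (div_pos hδ four_pos))).and
      (mem_nhdsWithin_of_mem_nhds (Ioi_mem_nhds (sub_one_lt ρ))))).exists
  have event_eq (n : ℕ) (ω : WalkSpace) :
      (walk pE pO ω.1 ω.2 n / n : ℝ) ≤ E.speedMinus pE pO ρ - δ ↔
        -E.speedMinus pE pO ρ + δ ≤ ((-1 : ℤ) : ℝ) * (walkFrom pE pO 0 ω.1 ω.2 n / n) := by
    rw [walk_eq_walkFrom]
    push_cast
    constructor <;> intro h <;> linarith
  simp only [event_eq]
  refine eventually_deviation_le hν hdrift hcover hp hρ hr isUnit_one.neg ?_ hδ ?_ ?_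
  · push_cast
    constructor <;> linarith [show r < ρ from hrρ, show ρ - 1 < r from lt_r]
  · simpa using abs_speedMinus_le hν hdrift hcover hp hρ
  · push_cast
    linarith

end Environment

theorem lemma4p2 (a b : ℝ) (ha : 0 ≤ a) (E : Environment a b) (ν : ℝ) (hν : 0 < ν)
    (hdrift : E.NoDriftIn ν) (hcover : E.Covering ν)
    (pE pO : ℝ) (hpE : 0 ≤ pE) (hp : pE < pO) (hpO : pO ≤ 1)
    (ρ : ℝ) (hρ : ρ ∈ Set.Ioo a b) :
    -- `v⁺(ρ)` and `v⁻(ρ)` are well defined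
    ((𝓝[E.speedDomain pE pO ∩ Set.Ioi ρ] ρ).NeBot ∧
      Tendsto (E.speed pE pO) (𝓝[E.speedDomain pE pO ∩ Set.Ioi ρ] ρ)
        (𝓝 (E.speedPlus pE pO ρ)) ∧
      (𝓝[E.speedDomain pE pO ∩ Set.Iio ρ] ρ).NeBot ∧
      Tendsto (E.speed pE pO) (𝓝[E.speedDomain pE pO ∩ Set.Iio ρ] ρ)
        (𝓝 (E.speedMinus pE pO ρ))) ∧
    -- the deviation bound
    ∀ δ : ℝ, 0 < δ → ∃ k₀ : ℕ, ∀ n L : ℕ, k₀ < L → L ≤ n → 12 * (L : ℝ) / δ ≤ n →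
      ∀ f : ℝ, Real.log L ^ 90 ≤ f → f ≤ (L : ℝ) ^ (1 / 10 : ℝ) →
        (annealed (E.law ρ)).real
            {ω | (walk pE pO ω.1 ω.2 n : ℝ) / n ∉
              Set.Ioo (E.speedMinus pE pO ρ - δ) (E.speedPlus pE pO ρ + δ)} ≤
          2 * ((⌈(n : ℝ) / L⌉₊ : ℝ) - 1) ^ 2 * Real.exp (-f ^ (1 / 40 : ℝ)) +
            2 * Real.exp (-(δ ^ 2 * n) / (2 ^ 9 * L)) := by
  refine ⟨⟨Environment.neBot_nhdsWithin_speedDomain_Ioi hν hdrift hcover hp.le hρ,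
    Environment.tendsto_speedPlus hp.le ρ,
    Environment.neBot_nhdsWithin_speedDomain_Iio hν hdrift hcover hp.le hρ,
    Environment.tendsto_speedMinus hp.le ρ⟩, fun δ hδ => ?_⟩
  obtain ⟨k₀, hk₀⟩ := eventually_atTop.mp
    ((Environment.eventually_upper_deviation_le hν hdrift hcover hp.le hρ hδ).and
      (Environment.eventually_lower_deviation_le hν hdrift hcover hp.le hρ hδ))
  refine ⟨k₀, fun n L hL _ hn f hlog_le hf_le => ?_⟩
  obtain ⟨upper, lower⟩ := hk₀ L hL.le
  have hf : 0 ≤ f := (Even.pow_nonneg (by decide) _).trans hlog_le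
  have rpow_le : f ^ (1 / 40 : ℝ) ≤ (L : ℝ) ^ (1 / 400 : ℝ) :=
    calc f ^ (1 / 40 : ℝ) ≤ ((L : ℝ) ^ (1 / 10 : ℝ)) ^ (1 / 40 : ℝ) := by gcongr
      _ = (L : ℝ) ^ (1 / 400 : ℝ) := by rw [← Real.rpow_mul L.cast_nonneg]; norm_num
  have blocks_le : ((⌈(n : ℝ) / L⌉₊ : ℝ) - 1) ^ 2 * Real.exp (-(L : ℝ) ^ (1 / 400 : ℝ)) ≤
      ((⌈(n : ℝ) / L⌉₊ : ℝ) - 1) ^ 2 * Real.exp (-f ^ (1 / 40 : ℝ)) := by gcongr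
  have event_subset : {ω : WalkSpace | (walk pE pO ω.1 ω.2 n : ℝ) / n ∉
        Set.Ioo (E.speedMinus pE pO ρ - δ) (E.speedPlus pE pO ρ + δ)} ⊆
      {ω | E.speedPlus pE pO ρ + δ ≤ walk pE pO ω.1 ω.2 n / n} ∪
        {ω | walk pE pO ω.1 ω.2 n / n ≤ E.speedMinus pE pO ρ - δ} := fun ω hω =>
    (not_and_or.mp hω).symm.imp not_lt.mp not_lt.mp
  refine (measureReal_mono event_subset).trans ((measureReal_union_le _ _).trans ?_)
  linarith [upper n hn, lower n hn]
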